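/- For an integer $n\ge 0$ let $J_n(x)=\sum_{k\ge 0}\frac{(-1)^k}{k!\,(k+n)!}\left(\frac{x}{2}\right)^{2k+n}$ be the Bessel function of the first kind, and read $1/\Gamma$ as the entire function that vanishes at $0,-1,-2,\dots$. Let $M,m,l\ge 0$ be integers, let $\alpha_1,\dots,\alpha_M>0$ and $\beta_1,\dots,\beta_M>0$ be real, and let $\lambda$ be real, with $$\sum_{k=1}^M\alpha_k>m+\frac12\left(M+\frac12\right),\qquad \lambda\ge\pi\sum_{k=1}^M\beta_k .$$ Put $$h(x)=\frac{x^{2m}}{\prod_{k=1}^M\Gamma(\alpha_k+\beta_kx)\,\Gamma(\alpha_k-\beta_kx)},\qquad a_s^{(M)}=\frac{d^{2s}}{dx^{2s}}\,\frac{1}{\prod_{k=1}^M\Gamma(\alpha_k+\beta_kx)\,\Gamma(\alpha_k-\beta_kx)}\bigg|_{x=0}\quad(s=0,1,2,\dots).$$ Then $x\mapsto h(x)J_{2l+1}(\lambda x)$ is absolutely integrable on $(0,\infty)$. If $l\ge m$, then $$\int_0^\infty h(x)\,J_{2l+1}(\lambda x)\,dx=\frac12\sum_{s=0}^{l-m}\frac{a_s^{(M)}}{(2s)!}\,\frac{(l+m+s)!}{(l-m-s)!}\left(\frac2\lambda\right)^{2m+2s+1},$$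 and if $l<m$, then $$\int_0^\infty h(x)\,J_{2l+1}(\lambda x)\,dx=0 .$$ In particular, $$\int_0^\infty\frac{J_1(\pi x)}{\Gamma(1+x)\,\Gamma(1-x)}\,dx=\frac1\pi ,$$ and for all integers $m\ge 0$, $n\ge 1$ and all real $\lambda\ge\pi$, $$\frac1\pi=\frac{\left[\prod_{k=1}^{m+n}(2k-1)\right]^2\lambda^{2m+1}}{(2m)!\;2^{4m+2n}}\int_0^\infty\frac{x^{2m}\,J_{2m+1}(\lambda x)}{\Gamma\!\left(m+n+\frac12+x\right)\Gamma\!\left(m+n+\frac12-x\right)}\,dx .$$ -/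

import Mathlib

/-- The Bessel function of the first kind `J_n` of integer order `n ≥ 0` at a real argument,
`J_n(x) = ∑_{k ≥ 0} (-1)^k / (k! (k+n)!) (x/2)^(2k+n)`. -/
noncomputable def besselJ (n : ℕ) (x : ℝ) : ℝ :=
  ∑' k : ℕ, (-1 : ℝ) ^ k / ((k.factorial : ℝ) * ((k + n).factorial : ℝ)) * (x / 2) ^ (2 * k + n)

/-- The series defining `besselJ` converges absolutely for every order and argument. -/
theorem summable_besselJ (n : ℕ) (x : ℝ) :
    Summable fun k : ℕ =>
      (-1 : ℝ) ^ k / ((k.factorial : ℝ) * ((k + n).factorial : ℝ)) * (x / 2) ^ (2 * k + n) := by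
  have h := (Real.summable_pow_div_factorial ((x / 2) ^ 2)).mul_left (|x / 2| ^ n)
  refine Summable.of_norm_bounded h fun k => ?_
  have h1 : (1 : ℝ) ≤ ((k + n).factorial : ℝ) := by
    exact_mod_cast Nat.one_le_iff_ne_zero.mpr (Nat.factorial_ne_zero _)
  have h2 : (0 : ℝ) < (k.factorial : ℝ) := by exact_mod_cast Nat.factorial_pos k
  have h3 : ‖(-1 : ℝ) ^ k / ((k.factorial : ℝ) * ((k + n).factorial : ℝ))
      * (x / 2) ^ (2 * k + n)‖ =
      (|x / 2| ^ n * ((x / 2) ^ 2) ^ k) / ((k.factorial : ℝ) * ((k + n).factorial : ℝ)) := by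
    rw [norm_mul, norm_div, norm_pow, norm_neg, norm_one, one_pow, norm_mul, norm_pow,
      Real.norm_eq_abs, Real.norm_eq_abs, Real.norm_eq_abs, Nat.abs_cast, Nat.abs_cast,
      pow_add, pow_mul, sq_abs]
    ring
  rw [h3, ← mul_div_assoc]
  apply div_le_div_of_nonneg_left (by positivity) h2
  nlinarith

/-- The reciprocal of the product of gamma functions,
`x ↦ 1 / ∏_{k=1}^M Γ(α_k + β_k x) Γ(α_k - β_k x)`.  At a pole of one of the gamma functions
Mathlib has `Real.Gamma = 0`, hence the value here is `0`, which is the value there of the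
entire function `1 / Γ`. -/
noncomputable def recipGammaProd {M : ℕ} (α β : Fin M → ℝ) (x : ℝ) : ℝ :=
  1 / ∏ k, (Real.Gamma (α k + β k * x) * Real.Gamma (α k - β k * x))

/-- The coefficient `a_s^{(M)}`: the derivative of order `2s` at `0` of `recipGammaProd`. -/
noncomputable def gammaCoeff {M : ℕ} (α β : Fin M → ℝ) (s : ℕ) : ℝ :=
  iteratedDeriv (2 * s) (recipGammaProd α β) 0

/-! The core fact is an orthogonality. Let `f` be an odd entire function of exponential type `a <
lam`, decaying quadratically. Its Fourier transform is odd and lives on `|2πξ| ≤ a`. The Laplace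
transform of `J₀(lam x)` at `p = ε - 2πiξ` is `(p² + lam²)^(-1/2)`, and as `ε → 0` it becomes a
function even in `ξ` on that set. Hence `∫₀^∞ f(x) J₀(lam x) dx = 0`
(`DecayingExpType.integral_mul_besselJ_zero_of_odd`).

For even `f`, integrating by parts with `J₀' = -J₁` and `2 J_{n+1}' = J_n - J_{n+2}` brings `∫ f
J_{2l+1}` down to integrals of odd derivatives of `f` against `J₀`, all zero. What survives are
derivatives of `f` at `0`, with binomial coefficients
(`DecayingExpType.integral_mul_besselJ_two_mul_add_one`).

The function `h` has type at most `π ∑ β_k`, possibly equal to `lam`, and its bound on the real line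
is only `O(x^e)` with `e < -1/2`. So it is multiplied by a power of `sin(εz)/(εz)`, `lam` is raised
slightly, and `ε → 0`; dominated convergence applies because `J_n(x) = O(x^(-1/2))`
(`integral_mul_besselJ_of_expType`). Both bounds on `h` come from the reflection formula: the sine
supplies the type, a quotient of gamma values the power of `x`. The factor `x^(2m)` kills all
derivatives at `0` of order below `2m`, which explains the vanishing for `l < m`. -/

/-! ### Power series of `J_n`: derivatives and recurrence. -/

theorem HasSum.of_eq {f g : ℕ → ℝ} {a b : ℝ} (h : HasSum f a) (hf : ∀ k, g k = f k)
    (hab : b = a) : HasSum g b := by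
  rw [hab, funext hf]
  exact h

theorem hasSum_besselJ (n : ℕ) (x : ℝ) :
    HasSum (fun k : ℕ =>
      (-1 : ℝ) ^ k / ((k.factorial : ℝ) * ((k + n).factorial : ℝ)) * (x / 2) ^ (2 * k + n))
      (besselJ n x) :=
  (summable_besselJ n x).hasSum

theorem besselJ_zero_zero : besselJ 0 0 = 1 := by
  refine (hasSum_besselJ 0 0).unique ?_
  convert hasSum_ite_eq (0 : ℕ) (1 : ℝ) using 1
  funext k
  rcases k with _ | k <;> simp

theorem besselJ_succ_zero (n : ℕ) : besselJ (n + 1) 0 = 0 := by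
  refine (hasSum_besselJ (n + 1) 0).unique ?_
  convert hasSum_zero using 1
  funext k
  simp

theorem hasDerivAt_besselJ_tsum (n : ℕ) (x : ℝ) :
    HasDerivAt (besselJ n) (∑' k : ℕ, (-1 : ℝ) ^ k / ((k.factorial : ℝ) * ((k + n).factorial : ℝ))
      * (((2 * k + n : ℕ) : ℝ) * (x / 2) ^ (2 * k + n - 1) * (1 / 2))) x := by
  -- The summand `2` makes `R / 2 ≥ 1`, so that the exponent `2k + n - 1` may be raised to `2k + n`
  -- in the uniform bound. The factor `2k + n` from differentiation is absorbed by `(k + n)!`.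
  set R : ℝ := |x| + 2 with hR
  have hR2 : 1 ≤ R / 2 := by have := abs_nonneg x; linarith
  have hu : Summable fun k : ℕ => (R / 2) ^ n * (((R / 2) ^ 2) ^ k / (k.factorial : ℝ)) :=
    (Real.summable_pow_div_factorial ((R / 2) ^ 2)).mul_left _
  have hfun : besselJ n = fun y => ∑' k : ℕ, (-1 : ℝ) ^ k /
      ((k.factorial : ℝ) * ((k + n).factorial : ℝ)) * (y / 2) ^ (2 * k + n) := rfl
  rw [hfun]
  refine hasDerivAt_tsum_of_isPreconnected (t := Metric.ball 0 R) (y₀ := x)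
    (y := x) (g := fun (k : ℕ) (y : ℝ) => (-1 : ℝ) ^ k /
      ((k.factorial : ℝ) * ((k + n).factorial : ℝ)) * (y / 2) ^ (2 * k + n))
    (g' := fun (k : ℕ) (y : ℝ) => (-1 : ℝ) ^ k / ((k.factorial : ℝ) * ((k + n).factorial : ℝ))
      * (((2 * k + n : ℕ) : ℝ) * (y / 2) ^ (2 * k + n - 1) * (1 / 2))) hu
    Metric.isOpen_ball (convex_ball _ _).isPreconnected
    (fun k y _ => ?_) (fun k y hy => ?_) ?_ (summable_besselJ n x) ?_
  · exact (((hasDerivAt_id y).div_const 2).pow (2 * k + n)).const_mul _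
  · have hy' : |y| / 2 ≤ R / 2 := by
      have : |y| < R := by simpa using hy
      linarith
    have h1 : ((k + n : ℕ) : ℝ) ≤ ((k + n).factorial : ℝ) := by
      exact_mod_cast Nat.self_le_factorial _
    have h3 : (0 : ℝ) < ((k + n).factorial : ℝ) := by positivity
    have h2 : ((2 * k + n : ℕ) : ℝ) * (1 / 2) / ((k + n).factorial : ℝ) ≤ 1 := by
      rw [div_le_one h3]
      push_cast at h1 ⊢
      have : (0 : ℝ) ≤ n := by positivity
      linarith
    have h4 : (|y| / 2) ^ (2 * k + n - 1) ≤ (R / 2) ^ (2 * k + n) :=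
      (pow_le_pow_left₀ (by positivity) hy' _).trans (pow_le_pow_right₀ hR2 (Nat.sub_le _ _))
    rw [norm_mul, norm_div, norm_pow, norm_neg, norm_one, one_pow, norm_mul, norm_mul, norm_mul,
      norm_pow, norm_div]
    simp only [Real.norm_eq_abs, Nat.abs_cast, abs_two, abs_of_pos (one_half_pos (α := ℝ))]
    calc 1 / ((k.factorial : ℝ) * ((k + n).factorial : ℝ)) *
          (((2 * k + n : ℕ) : ℝ) * (|y| / 2) ^ (2 * k + n - 1) * (1 / 2))
        = (((2 * k + n : ℕ) : ℝ) * (1 / 2) / ((k + n).factorial : ℝ)) *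
          ((|y| / 2) ^ (2 * k + n - 1) / (k.factorial : ℝ)) := by field_simp
      _ ≤ 1 * ((R / 2) ^ (2 * k + n) / (k.factorial : ℝ)) := by gcongr
      _ = _ := by rw [pow_add, pow_mul]; ring
  · simp [hR]
  · simp [hR]

theorem hasDerivAt_besselJ_zero (x : ℝ) : HasDerivAt (besselJ 0) (-besselJ 1 x) x := by
  convert hasDerivAt_besselJ_tsum 0 x using 1
  symm
  refine HasSum.tsum_eq ?_
  rw [← hasSum_nat_add_iff' 1]
  convert (hasSum_besselJ 1 x).neg using 1
  · funext k
    have h1 : (k.factorial : ℝ) ≠ 0 := by positivity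
    have h2 : ((k + 1).factorial : ℝ) ≠ 0 := by positivity
    have : 2 * (k + 1) + 0 - 1 = 2 * k + 1 := by omega
    rw [this, add_zero, Nat.factorial_succ]
    push_cast
    field_simp
    ring
  · simp

theorem hasDerivAt_besselJ_succ (n : ℕ) (x : ℝ) :
    HasDerivAt (besselJ (n + 1)) ((besselJ n x - besselJ (n + 2) x) / 2) x := by
  convert hasDerivAt_besselJ_tsum (n + 1) x using 1
  symm
  refine HasSum.tsum_eq ?_
  have hA := (hasSum_besselJ n x).div_const 2
  have hB : HasSum (fun k : ℕ => (-1 : ℝ) ^ k / ((k.factorial : ℝ) * ((k + (n + 1)).factorial : ℝ))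
      * (((2 * k + (n + 1) : ℕ) : ℝ) * (x / 2) ^ (2 * k + (n + 1) - 1) * (1 / 2)) -
      (-1 : ℝ) ^ k / ((k.factorial : ℝ) * ((k + n).factorial : ℝ)) * (x / 2) ^ (2 * k + n) / 2)
      (-(besselJ (n + 2) x / 2)) := by
    rw [← hasSum_nat_add_iff' 1]
    convert ((hasSum_besselJ (n + 2) x).div_const 2).neg using 1
    · funext k
      have h1 : (k.factorial : ℝ) ≠ 0 := by positivity
      have h2 : ((k + (n + 1)).factorial : ℝ) ≠ 0 := by positivity
      have e1 : 2 * (k + 1) + (n + 1) - 1 = 2 * k + (n + 2) := by omega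
      have e2 : 2 * (k + 1) + n = 2 * k + (n + 2) := by omega
      have e3 : k + 1 + (n + 1) = (k + (n + 1)) + 1 := by omega
      have e4 : k + 1 + n = k + (n + 1) := by omega
      have e5 : k + (n + 2) = (k + (n + 1)) + 1 := by omega
      rw [e1, e2, e3, e4, e5, Nat.factorial_succ k, Nat.factorial_succ (k + (n + 1))]
      push_cast
      field_simp
      ring
    · have h1 : (n.factorial : ℝ) ≠ 0 := by positivity
      simp [Nat.factorial_succ]
      field_simp
      ring
  exact (hA.add hB).of_eq (fun k => by ring) (by ring)

theorem besselJ_recurrence (n : ℕ) (x : ℝ) :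
    x * (besselJ n x + besselJ (n + 2) x) = 2 * (n + 1) * besselJ (n + 1) x := by
  have hA := (hasSum_besselJ n x).mul_left x
  have hC := (hasSum_besselJ (n + 1) x).mul_left (2 * ((n : ℝ) + 1))
  have hB : HasSum (fun k : ℕ => 2 * ((n : ℝ) + 1) * ((-1 : ℝ) ^ k / ((k.factorial : ℝ) *
      ((k + (n + 1)).factorial : ℝ)) * (x / 2) ^ (2 * k + (n + 1))) -
      x * ((-1 : ℝ) ^ k / ((k.factorial : ℝ) * ((k + n).factorial : ℝ)) * (x / 2) ^ (2 * k + n)))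
      (x * besselJ (n + 2) x) := by
    rw [← hasSum_nat_add_iff' 1]
    refine ((hasSum_besselJ (n + 2) x).mul_left x).of_eq (fun k => ?_) ?_
    · have h1 : (k.factorial : ℝ) ≠ 0 := by positivity
      have h2 : ((k + (n + 1)).factorial : ℝ) ≠ 0 := by positivity
      have e1 : 2 * (k + 1) + (n + 1) = 2 * k + (n + 2) + 1 := by omega
      have e2 : 2 * (k + 1) + n = 2 * k + (n + 2) := by omega
      have e3 : k + 1 + (n + 1) = (k + (n + 1)) + 1 := by omega
      have e4 : k + 1 + n = k + (n + 1) := by omega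
      have e5 : k + (n + 2) = (k + (n + 1)) + 1 := by omega
      rw [e1, e2, e3, e4, e5, Nat.factorial_succ k, Nat.factorial_succ (k + (n + 1))]
      push_cast
      field_simp
      ring
    · have h1 : (n.factorial : ℝ) ≠ 0 := by positivity
      simp [Nat.factorial_succ]
      field_simp
      ring
  have := (hA.add hB).unique (hC.of_eq (fun k => by ring) rfl)
  linarith

theorem continuous_besselJ (n : ℕ) : Continuous (besselJ n) :=
  continuous_iff_continuousAt.2 fun x => (hasDerivAt_besselJ_tsum n x).continuousAt

/-! ### Integral formula for `J₀` and the decay `x^(-1/2)` of `J_n`. -/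

/-- Expand the cosine in its power series and integrate term by term; the Wallis integrals of
`sin^(2k)` turn the `k`-th term into that of `J₀`. -/
theorem besselJ_zero_eq_integral (x : ℝ) :
    besselJ 0 x = 1 / Real.pi * ∫ θ in (0 : ℝ)..Real.pi, Real.cos (x * Real.sin θ) := by
  have key : HasSum (fun k : ℕ => ∫ θ in (0 : ℝ)..Real.pi,
      (-1 : ℝ) ^ k * (x * Real.sin θ) ^ (2 * k) / ((2 * k).factorial : ℝ))
      (∫ θ in (0 : ℝ)..Real.pi, Real.cos (x * Real.sin θ)) := by
    refine intervalIntegral.hasSum_integral_of_dominated_convergence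
      (fun k _ => |x| ^ (2 * k) / ((2 * k).factorial : ℝ)) (fun k => ?_) (fun k => ?_) ?_ ?_ ?_
    · exact Continuous.aestronglyMeasurable (by fun_prop)
    · refine Filter.Eventually.of_forall fun θ _ => ?_
      rw [norm_div, norm_mul, norm_pow, norm_neg, norm_one, one_pow, one_mul, norm_pow, norm_mul,
        Real.norm_natCast]
      gcongr
      exact mul_le_of_le_one_right (norm_nonneg _) (Real.abs_sin_le_one θ)
    · refine Filter.Eventually.of_forall fun θ _ => ?_
      exact (Real.summable_pow_div_factorial |x|).comp_injective
        (mul_right_injective₀ (two_ne_zero (α := ℕ)))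
    · exact intervalIntegrable_const
    · exact Filter.Eventually.of_forall fun θ _ => Real.hasSum_cos _
  refine (hasSum_besselJ 0 x).unique ?_
  refine (key.mul_left (1 / Real.pi)).of_eq (fun k => ?_) rfl
  have e : ∀ θ, (-1 : ℝ) ^ k * (x * Real.sin θ) ^ (2 * k) / ((2 * k).factorial : ℝ) =
      ((-1 : ℝ) ^ k * x ^ (2 * k) / ((2 * k).factorial : ℝ)) * Real.sin θ ^ (2 * k) := by
    intro θ; rw [mul_pow]; ring
  simp_rw [e]
  rw [intervalIntegral.integral_const_mul, integral_sin_pow_even]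
  have hprod : ∏ i ∈ Finset.range k, ((2 * (i : ℝ) + 1) / (2 * i + 2)) =
      ((2 * k).factorial : ℝ) / (4 ^ k * (k.factorial : ℝ) ^ 2) := by
    clear e key
    induction k with
    | zero => simp
    | succ k ih =>
      rw [Finset.prod_range_succ, ih, show 2 * (k + 1) = 2 * k + 1 + 1 by ring,
        Nat.factorial_succ, Nat.factorial_succ, Nat.factorial_succ]
      push_cast
      field_simp
      ring
  rw [hprod]
  have := Real.pi_ne_zero
  field_simp
  simp only [add_zero]
  rw [show x ^ (2 * k) = (2 * (x / 2)) ^ (2 * k) by congr 1; ring, mul_pow, pow_mul 2]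
  norm_num
  ring

theorem abs_besselJ_zero_le_one (x : ℝ) : |besselJ 0 x| ≤ 1 := by
  rw [besselJ_zero_eq_integral, abs_mul]
  have h : ‖∫ θ in (0 : ℝ)..Real.pi, Real.cos (x * Real.sin θ)‖ ≤ 1 * |Real.pi - 0| :=
    intervalIntegral.norm_integral_le_of_norm_le_const fun θ _ => Real.abs_cos_le_one _
  rw [sub_zero, one_mul, Real.norm_eq_abs] at h
  have hp := Real.pi_pos
  rw [abs_of_pos (by positivity : 0 < 1 / Real.pi)]
  rw [abs_of_pos hp] at h
  calc _ ≤ 1 / Real.pi * Real.pi := by gcongr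
    _ = 1 := by field_simp

theorem hasDerivAt_besselJ_one {x : ℝ} (hx : x ≠ 0) :
    HasDerivAt (besselJ 1) (besselJ 0 x - besselJ 1 x / x) x := by
  have h := hasDerivAt_besselJ_succ 0 x
  have r := besselJ_recurrence 0 x
  simp only [zero_add, Nat.cast_zero, mul_one] at h r
  convert h using 1
  field_simp
  linarith

/-- An energy argument. The corrected energy `G` has derivative `J₀J₁/x`, and for `x ≥ 1` it is at
least half of `x(J₀² + J₁²)`. Therefore `G' ≤ G/x²`, and `G(x) exp(1/x)` is nonincreasing on `[1,
∞)`. -/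
theorem exists_mul_sq_besselJ_zero_one_le :
    ∃ B : ℝ, ∀ x : ℝ, 1 ≤ x → x * (besselJ 0 x ^ 2 + besselJ 1 x ^ 2) ≤ B := by
  set G : ℝ → ℝ := fun x => x * (besselJ 0 x ^ 2 + besselJ 1 x ^ 2) - besselJ 0 x * besselJ 1 x
    with hG
  have hpos : ∀ x : ℝ, 1 ≤ x → x * (besselJ 0 x ^ 2 + besselJ 1 x ^ 2) ≤ 2 * G x := by
    intro x hx
    simp only [hG]
    nlinarith [sq_nonneg (besselJ 0 x - besselJ 1 x), sq_nonneg (besselJ 0 x),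
      sq_nonneg (besselJ 1 x)]
  have hd : ∀ x : ℝ, 0 < x → HasDerivAt G (besselJ 0 x * besselJ 1 x / x) x := by
    intro x hx
    have h0 := hasDerivAt_besselJ_zero x
    have h1 := hasDerivAt_besselJ_one hx.ne'
    convert! ((hasDerivAt_id x).mul ((h0.pow 2).add (h1.pow 2))).sub (h0.mul h1) using 1
    simp only [id_eq, Nat.cast_ofNat, Nat.add_one_sub_one, pow_one, Pi.add_apply, Pi.pow_apply]
    field_simp
    ring
  have hdK : ∀ x : ℝ, 0 < x → HasDerivAt (fun y => G y * Real.exp y⁻¹)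
      ((besselJ 0 x * besselJ 1 x / x - G x / x ^ 2) * Real.exp x⁻¹) x := by
    intro x hx
    convert! (hd x hx).mul ((hasDerivAt_inv hx.ne').exp) using 1
    field_simp
    ring
  have hanti : AntitoneOn (fun y => G y * Real.exp y⁻¹) (Set.Ici 1) := by
    refine antitoneOn_of_deriv_nonpos (convex_Ici 1) (fun x hx => ?_) (fun x hx => ?_)
      (fun x hx => ?_)
    · exact (hdK x (zero_lt_one.trans_le hx)).continuousAt.continuousWithinAt
    · rw [interior_Ici] at hx
      exact (hdK x (zero_lt_one.trans hx)).differentiableAt.differentiableWithinAt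
    · rw [interior_Ici] at hx
      have hx1 : (1 : ℝ) < x := hx
      have hx0 : 0 < x := zero_lt_one.trans hx
      rw [(hdK x hx0).deriv]
      refine mul_nonpos_of_nonpos_of_nonneg ?_ (Real.exp_pos _).le
      have := hpos x hx1.le
      rw [sub_nonpos, div_le_div_iff₀ hx0 (by positivity)]
      nlinarith [mul_nonneg hx0.le (sq_nonneg (besselJ 0 x - besselJ 1 x))]
  refine ⟨2 * (G 1 * Real.exp 1⁻¹), fun x hx => (hpos x hx).trans ?_⟩
  have h1 := hanti (Set.mem_Ici.2 le_rfl) (Set.mem_Ici.2 hx) hx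
  have hx0 : 0 < x := zero_lt_one.trans_le hx
  have hGx : 0 ≤ G x := by
    have : 0 ≤ x * (besselJ 0 x ^ 2 + besselJ 1 x ^ 2) := by positivity
    have := hpos x hx
    linarith
  have h2 : G x ≤ G x * Real.exp x⁻¹ :=
    le_mul_of_one_le_right hGx (Real.one_le_exp (by positivity))
  linarith

theorem exists_abs_besselJ_mul_sqrt_le (n : ℕ) :
    ∃ B : ℝ, ∀ x : ℝ, 1 ≤ x → |besselJ n x| * √x ≤ B := by
  -- The three-term recurrence needs bounds for two consecutive orders, so the induction carries
  -- both.
  suffices h : (∃ B : ℝ, ∀ x : ℝ, 1 ≤ x → |besselJ n x| * √x ≤ B) ∧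
      ∃ B : ℝ, ∀ x : ℝ, 1 ≤ x → |besselJ (n + 1) x| * √x ≤ B from h.1
  induction n with
  | zero =>
    obtain ⟨B, hB⟩ := exists_mul_sq_besselJ_zero_one_le
    have aux : ∀ (x y : ℝ), 1 ≤ x → x * y ^ 2 ≤ B → |y| * √x ≤ √B := by
      intro x y hx h
      rw [← Real.sqrt_sq_eq_abs, ← Real.sqrt_mul (sq_nonneg y)]
      exact Real.sqrt_le_sqrt (by linarith)
    refine ⟨⟨√B, fun x hx => aux x _ hx ?_⟩, ⟨√B, fun x hx => aux x _ hx ?_⟩⟩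
    · have := hB x hx
      nlinarith [sq_nonneg (besselJ 1 x)]
    · have := hB x hx
      simp only [zero_add]
      nlinarith [sq_nonneg (besselJ 0 x)]
  | succ n ih =>
    obtain ⟨⟨A, hA⟩, ⟨B, hB⟩⟩ := ih
    refine ⟨⟨B, hB⟩, ⟨2 * (n + 1) * B + A, fun x hx => ?_⟩⟩
    have hx0 : 0 < x := zero_lt_one.trans_le hx
    have e : besselJ (n + 1 + 1) x = 2 * (n + 1) * besselJ (n + 1) x / x - besselJ n x := by
      have := besselJ_recurrence n x
      rw [eq_sub_iff_add_eq, eq_div_iff hx0.ne']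
      linarith
    have h1 : |besselJ (n + 1 + 1) x| ≤ 2 * (n + 1) * |besselJ (n + 1) x| + |besselJ n x| := by
      rw [e]
      refine (abs_sub _ _).trans ?_
      gcongr
      rw [abs_div, abs_mul, abs_of_pos hx0, abs_of_pos (by positivity : (0 : ℝ) < 2 * (n + 1))]
      exact div_le_self (by positivity) hx
    calc _ ≤ (2 * (n + 1) * |besselJ (n + 1) x| + |besselJ n x|) * √x := by gcongr
      _ = 2 * (n + 1) * (|besselJ (n + 1) x| * √x) + |besselJ n x| * √x := by ring
      _ ≤ _ := by
        have := hA x hx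
        have := hB x hx
        gcongr

theorem exists_abs_besselJ_le (n : ℕ) :
    ∃ B : ℝ, 0 ≤ B ∧ ∀ x : ℝ, 0 ≤ x → |besselJ n x| ≤ B * (1 + x) ^ (-(1 / 2) : ℝ) := by
  obtain ⟨B, hB⟩ := exists_abs_besselJ_mul_sqrt_le n
  obtain ⟨C, hC⟩ := (isCompact_Icc (a := (0 : ℝ)) (b := 1)).exists_bound_of_continuousOn
    (continuous_besselJ n).continuousOn
  have hB0 : 0 ≤ B := (by positivity : (0 : ℝ) ≤ |besselJ n 1| * √1).trans (hB 1 le_rfl)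
  have hC0 : 0 ≤ C := (norm_nonneg _).trans (hC 0 (by simp))
  refine ⟨√2 * (B + C), by positivity, fun x hx => ?_⟩
  rw [Real.rpow_neg (by positivity), ← Real.sqrt_eq_rpow, ← div_eq_mul_inv,
    le_div_iff₀ (by positivity)]
  rcases le_total x 1 with h | h
  · have h1 := hC x ⟨hx, h⟩
    rw [Real.norm_eq_abs] at h1
    have h2 : √(1 + x) ≤ √2 := Real.sqrt_le_sqrt (by linarith)
    calc _ ≤ (B + C) * √2 := by gcongr; linarith
      _ = _ := by ring
  · have h1 := hB x h
    have h2 : √(1 + x) ≤ √2 * √x := by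
      rw [← Real.sqrt_mul (by norm_num)]
      exact Real.sqrt_le_sqrt (by linarith)
    calc _ ≤ |besselJ n x| * (√2 * √x) := by gcongr
      _ = √2 * (|besselJ n x| * √x) := by ring
      _ ≤ √2 * (B + C) := by gcongr; linarith

theorem exists_abs_besselJ_le_const (n : ℕ) :
    ∃ B : ℝ, 0 ≤ B ∧ ∀ x : ℝ, 0 ≤ x → |besselJ n x| ≤ B := by
  obtain ⟨B, hB0, hB⟩ := exists_abs_besselJ_le n
  refine ⟨B, hB0, fun x hx => (hB x hx).trans (mul_le_of_le_one_right hB0 ?_)⟩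
  exact Real.rpow_le_one_of_one_le_of_nonpos (by linarith) (by norm_num)

/-! ### Functions of exponential type and the support of their Fourier transform. -/

/-- Entire functions of exponential type at most `a` which decay quadratically along
horizontal lines. -/
structure DecayingExpType (a : ℝ) (f : ℂ → ℂ) : Prop where
  differentiable : Differentiable ℂ f
  bound : ∃ C : ℝ, 0 ≤ C ∧
    ∀ z : ℂ, ‖f z‖ ≤ C * ((1 + ‖z‖) ^ (-2 : ℝ) * Real.exp (a * |z.im|))

namespace DecayingExpType

variable {a : ℝ} {f : ℂ → ℂ}

/-- Cauchy's estimate on the unit circle about `z`: moving by `1` costs a factor `4` in the weight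
and `exp a` in the exponential. -/
theorem deriv (ha : 0 ≤ a) (hf : DecayingExpType a f) : DecayingExpType a (deriv f) := by
  obtain ⟨C, hC0, hC⟩ := hf.bound
  refine ⟨hf.differentiable.deriv, C * (4 * Real.exp a), by positivity, fun z => ?_⟩
  have h := Complex.norm_deriv_le_of_forall_mem_sphere_norm_le (c := z) (R := 1) one_pos
    hf.differentiable.diffContOnCl
    (C := C * (4 * Real.exp a) * ((1 + ‖z‖) ^ (-2 : ℝ) * Real.exp (a * |z.im|)))
    (fun w hw => ?_)
  · simpa using h
  refine (hC w).trans ?_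
  have hwz : ‖w - z‖ = 1 := by simpa [dist_eq_norm] using hw
  have h1 : |w.im| ≤ |z.im| + 1 := by
    have h2 : |(w - z).im| ≤ 1 := hwz ▸ Complex.abs_im_le_norm _
    have h3 : w.im = z.im + (w - z).im := by simp
    rw [h3]
    exact (abs_add_le _ _).trans (by linarith)
  have h4 : ‖z‖ ≤ ‖w‖ + 1 := by
    have : z = w - (w - z) := by ring
    calc ‖z‖ = ‖w - (w - z)‖ := by rw [← this]
      _ ≤ ‖w‖ + ‖w - z‖ := norm_sub_le _ _
      _ = _ := by rw [hwz]
  have h5 : (1 + ‖w‖) ^ (-2 : ℝ) ≤ 4 * (1 + ‖z‖) ^ (-2 : ℝ) := by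
    have hw0 : 0 < 1 + ‖w‖ := by positivity
    have hz0 : 0 < 1 + ‖z‖ := by positivity
    rw [Real.rpow_neg hw0.le, Real.rpow_neg hz0.le, Real.rpow_two, Real.rpow_two,
      ← div_eq_mul_inv, inv_eq_one_div, div_le_div_iff₀ (by positivity) (by positivity)]
    nlinarith [norm_nonneg w, norm_nonneg z]
  have h6 : Real.exp (a * |w.im|) ≤ Real.exp a * Real.exp (a * |z.im|) := by
    rw [← Real.exp_add]
    gcongr
    nlinarith
  calc C * ((1 + ‖w‖) ^ (-2 : ℝ) * Real.exp (a * |w.im|))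
      ≤ C * ((4 * (1 + ‖z‖) ^ (-2 : ℝ)) * (Real.exp a * Real.exp (a * |z.im|))) := by gcongr
    _ = _ := by ring

theorem exists_norm_ofReal_le (hf : DecayingExpType a f) :
    ∃ C : ℝ, 0 ≤ C ∧ ∀ x : ℝ, ‖f x‖ ≤ C * (1 + ‖x‖) ^ (-2 : ℝ) := by
  obtain ⟨C, hC0, hC⟩ := hf.bound
  exact ⟨C, hC0, fun x => by simpa using hC x⟩

theorem continuous_ofReal (hf : DecayingExpType a f) : Continuous fun x : ℝ => f x :=
  hf.differentiable.continuous.comp Complex.continuous_ofReal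

theorem _root_.integrable_one_add_norm_rpow_neg_two :
    MeasureTheory.Integrable fun x : ℝ => (1 + ‖x‖) ^ (-2 : ℝ) :=
  integrable_one_add_norm (by simp)

theorem integrable (hf : DecayingExpType a f) :
    MeasureTheory.Integrable fun x : ℝ => f x := by
  obtain ⟨C, hC0, hC⟩ := hf.exists_norm_ofReal_le
  exact (integrable_one_add_norm_rpow_neg_two.const_mul C).mono'
    hf.continuous_ofReal.aestronglyMeasurable (Filter.Eventually.of_forall hC)

theorem tendsto_zero (hf : DecayingExpType a f) :
    Filter.Tendsto (fun x : ℝ => f x) Filter.atTop (nhds 0) := by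
  obtain ⟨C, hC0, hC⟩ := hf.exists_norm_ofReal_le
  refine squeeze_zero_norm hC ?_
  rw [← mul_zero C]
  refine Filter.Tendsto.const_mul C ?_
  exact (tendsto_rpow_neg_atTop two_pos).comp
    (Filter.tendsto_atTop_add_const_left _ 1 tendsto_norm_atTop_atTop)

end DecayingExpType

/-- Shift of the line of integration. -/
theorem integral_eq_integral_add_mul_I {K : ℂ → ℂ} (hK : Differentiable ℂ K) (Y C : ℝ)
    (hC : ∀ x y : ℝ, |y| ≤ |Y| → ‖K (x + y * Complex.I)‖ ≤ C * (1 + ‖x‖) ^ (-2 : ℝ)) :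
    ∫ x : ℝ, K x = ∫ x : ℝ, K (x + Y * Complex.I) := by
  have hint : ∀ y : ℝ, |y| ≤ |Y| →
      MeasureTheory.Integrable fun x : ℝ => K (x + y * Complex.I) := fun y hy =>
    (integrable_one_add_norm_rpow_neg_two.const_mul C).mono'
      (Continuous.aestronglyMeasurable (by have := hK.continuous; fun_prop))
      (Filter.Eventually.of_forall fun x => hC x y hy)
  have lim : ∀ y : ℝ, |y| ≤ |Y| → Filter.Tendsto
      (fun T : ℝ => ∫ x in (-T)..T, K (x + y * Complex.I)) Filter.atTop
      (nhds (∫ x : ℝ, K (x + y * Complex.I))) := fun y hy =>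
    MeasureTheory.intervalIntegral_tendsto_integral (hint y hy) Filter.tendsto_neg_atTop_atBot
      Filter.tendsto_id
  have h0 := lim 0 (by simp)
  have hY := lim Y le_rfl
  simp only [Complex.ofReal_zero, zero_mul, add_zero] at h0
  refine sub_eq_zero.1 (tendsto_nhds_unique (h0.sub hY) ?_)
  have hbd : ∀ T : ℝ, ‖(∫ x in (-T)..T, K x) - ∫ x in (-T)..T, K (x + Y * Complex.I)‖ ≤
      2 * (C * (1 + ‖T‖) ^ (-2 : ℝ) * |Y|) := by
    intro T
    have h := Complex.integral_boundary_rect_eq_zero_of_differentiableOn K (-T : ℝ)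
      ((T : ℂ) + Y * Complex.I) hK.differentiableOn
    simp only [Complex.ofReal_re, Complex.ofReal_im, Complex.add_re, Complex.mul_re,
      Complex.I_re, mul_zero, Complex.I_im, mul_one, sub_self, add_zero, Complex.add_im,
      Complex.mul_im, zero_add, Complex.ofReal_zero, zero_mul, smul_eq_mul] at h
    have hv : ∀ S : ℝ, ‖∫ y in (0 : ℝ)..Y, K (S + y * Complex.I)‖ ≤
        C * (1 + ‖S‖) ^ (-2 : ℝ) * |Y| := by
      intro S
      have := intervalIntegral.norm_integral_le_of_norm_le_const
        (f := fun y : ℝ => K (S + y * Complex.I)) (a := 0) (b := Y)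
        (C := C * (1 + ‖S‖) ^ (-2 : ℝ)) (fun y hy => hC S y ?_)
      · simpa using this
      · rcases Set.mem_uIoc.1 hy with h | h
        · rw [abs_of_pos h.1]; exact h.2.trans (le_abs_self _)
        · rw [abs_of_nonpos h.2, abs_of_neg (h.1.trans_le h.2)]; linarith [h.1]
    have e : (∫ x in (-T)..T, K x) - ∫ x in (-T)..T, K (x + Y * Complex.I) =
        Complex.I * (∫ y in (0 : ℝ)..Y, K ((-T : ℝ) + y * Complex.I)) -
        Complex.I * ∫ y in (0 : ℝ)..Y, K (T + y * Complex.I) := by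
      linear_combination h
    rw [e]
    refine (norm_sub_le _ _).trans ?_
    rw [norm_mul, norm_mul, Complex.norm_I, one_mul, one_mul]
    have h1 := hv T
    have h2 := hv (-T)
    rw [norm_neg] at h2
    linarith
  refine squeeze_zero_norm hbd ?_
  have : Filter.Tendsto (fun T : ℝ => (1 + ‖T‖) ^ (-2 : ℝ)) Filter.atTop (nhds 0) :=
    (tendsto_rpow_neg_atTop two_pos).comp
      (Filter.tendsto_atTop_add_const_left _ 1 tendsto_norm_atTop_atTop)
  simpa using ((this.const_mul C).mul_const |Y|).const_mul 2

-- The easy half of Paley–Wiener: moving the line of integration a distance `t` to the side where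
-- the exponential kernel decays bounds the transform by a constant times `exp(-(|2πξ| - a)t)`, and
-- `t` is arbitrary.
open scoped FourierTransform in
theorem DecayingExpType.fourier_eq_zero {a : ℝ} {f : ℂ → ℂ} (ha : 0 ≤ a)
    (hf : DecayingExpType a f) {ξ : ℝ} (hξ : a < |2 * Real.pi * ξ|) :
    𝓕 (fun x : ℝ => f x) ξ = 0 := by
  obtain ⟨C, hC0, hC⟩ := hf.bound
  set b : ℝ := 2 * Real.pi * ξ with hb
  set K : ℂ → ℂ := fun z => Complex.exp (-(b * z * Complex.I)) * f z with hKdef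
  have hK : Differentiable ℂ K := by
    have := hf.differentiable
    fun_prop
  have hF : 𝓕 (fun x : ℝ => f x) ξ = ∫ x : ℝ, K x := by
    rw [Real.fourier_real_eq_integral_exp_smul]
    congr 1 with x
    simp only [hKdef, smul_eq_mul, hb]
    congr 2
    push_cast
    ring
  have hKb : ∀ x y : ℝ, ‖K (x + y * Complex.I)‖ ≤
      C * Real.exp (b * y + a * |y|) * (1 + ‖x‖) ^ (-2 : ℝ) := by
    intro x y
    have h1 := hC (x + y * Complex.I)
    have h2 : ‖Complex.exp (-(b * (x + y * Complex.I) * Complex.I))‖ = Real.exp (b * y) := by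
      rw [Complex.norm_exp]
      simp
    have h3 : (1 + ‖(x : ℂ) + y * Complex.I‖) ^ (-2 : ℝ) ≤ (1 + ‖x‖) ^ (-2 : ℝ) := by
      refine Real.rpow_le_rpow_of_nonpos (by positivity) ?_ (by norm_num)
      have := Complex.abs_re_le_norm ((x : ℂ) + y * Complex.I)
      simp at this
      simpa using this
    have h4 : ((x : ℂ) + y * Complex.I).im = y := by simp
    rw [h4] at h1
    simp only [hKdef]
    rw [norm_mul, h2, Real.exp_add]
    calc _ ≤ Real.exp (b * y) * (C * ((1 + ‖x‖) ^ (-2 : ℝ) * Real.exp (a * |y|))) := by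
          gcongr
          exact h1.trans (by gcongr)
      _ = _ := by ring
  have hb0 : b ≠ 0 := by
    intro h
    rw [h, abs_zero] at hξ
    linarith
  have hb1 : |b| ≠ 0 := abs_ne_zero.2 hb0
  set σ : ℝ := b / |b| with hσ
  have hσb : b * σ = |b| := by
    rw [hσ]
    field_simp
    exact (sq_abs b).symm
  have hσ1 : |σ| = 1 := by rw [hσ, abs_div, abs_abs, div_self hb1]
  have hest : ∀ t : ℝ, 0 ≤ t → ‖∫ x : ℝ, K x‖ ≤
      (C * ∫ x : ℝ, (1 + ‖x‖) ^ (-2 : ℝ)) * Real.exp (-((|b| - a) * t)) := by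
    intro t ht
    have habs : |(-(σ * t))| = t := by rw [abs_neg, abs_mul, hσ1, one_mul, abs_of_nonneg ht]
    -- This growing constant only has to control the integrand uniformly on the strip, to justify
    -- the shift; the decaying bound is then taken on the new line alone.
    rw [integral_eq_integral_add_mul_I hK (-(σ * t)) (C * Real.exp (|b| * t + a * t))
      (fun x y hy => (hKb x y).trans ?_)]
    · refine (MeasureTheory.norm_integral_le_of_norm_le
        (integrable_one_add_norm_rpow_neg_two.const_mul (C * Real.exp (-((|b| - a) * t))))
        (Filter.Eventually.of_forall fun x => (hKb x _).trans_eq ?_)).trans_eq ?_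
      · rw [habs]
        congr 3
        linear_combination (-t) * hσb
      · rw [MeasureTheory.integral_const_mul]; ring
    · rw [habs] at hy
      gcongr C * Real.exp ?_ * _
      have : b * y ≤ |b| * |y| := by rw [← abs_mul]; exact le_abs_self _
      have : |b| * |y| ≤ |b| * t := by gcongr
      have : a * |y| ≤ a * t := by gcongr
      linarith
  rw [hF, ← norm_le_zero_iff]
  refine ge_of_tendsto (x := Filter.atTop) (b := ‖∫ x : ℝ, K x‖) (f := fun t : ℝ =>
    (C * ∫ x : ℝ, (1 + ‖x‖) ^ (-2 : ℝ)) * Real.exp (-((|b| - a) * t))) ?_ ?_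
  · rw [← mul_zero (C * ∫ x : ℝ, (1 + ‖x‖) ^ (-2 : ℝ))]
    refine Filter.Tendsto.const_mul _ (Real.tendsto_exp_neg_atTop_nhds_zero.comp ?_)
    exact Filter.tendsto_id.const_mul_atTop (sub_pos.2 hξ)
  · filter_upwards [Filter.eventually_ge_atTop 0] with t ht using hest t ht

/-! ### The Laplace transform of `J₀`. -/

theorem Complex.norm_sq_add_sq_ge {p : ℂ} (hp : 0 < p.re) (y : ℝ) :
    p.re ^ 2 ≤ ‖p ^ 2 + (y : ℂ) ^ 2‖ := by
  have e : p ^ 2 + (y : ℂ) ^ 2 = (p + y * I) * (p - y * I) := by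
    linear_combination ((y : ℂ) ^ 2) * I_sq
  rw [e, norm_mul, sq]
  have h1 : p.re ≤ ‖p + y * I‖ := by
    refine le_trans ?_ (Complex.re_le_norm _)
    simp
  have h2 : p.re ≤ ‖p - y * I‖ := by
    refine le_trans ?_ (Complex.re_le_norm _)
    simp
  gcongr

theorem Complex.sq_add_sq_ne_zero {p : ℂ} (hp : 0 < p.re) (y : ℝ) : p ^ 2 + (y : ℂ) ^ 2 ≠ 0 := by
  rw [← norm_pos_iff]
  exact (pow_pos hp 2).trans_le (norm_sq_add_sq_ge hp y)

/-- This keeps the principal square root of `p² + y²` differentiable in `y`. The imaginary part `2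
Re p Im p` vanishes only for real `p`, and then the real part is positive. -/
theorem Complex.sq_add_sq_mem_slitPlane {p : ℂ} (hp : 0 < p.re) (y : ℝ) :
    p ^ 2 + (y : ℂ) ^ 2 ∈ slitPlane := by
  rw [mem_slitPlane_iff]
  have hre : (p ^ 2 + (y : ℂ) ^ 2).re = p.re ^ 2 - p.im ^ 2 + y ^ 2 := by simp [sq]
  have him : (p ^ 2 + (y : ℂ) ^ 2).im = 2 * p.re * p.im := by simp [sq]; ring
  rw [hre, him]
  rcases eq_or_ne p.im 0 with h | h
  · left
    rw [h]
    nlinarith [pow_pos hp 2, sq_nonneg y]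
  · right
    exact mul_ne_zero (by positivity) h

/-- `∫₀^π dθ / (p² + μ² sin² θ)` in closed form. -/
theorem integral_div_sq_add_sq_sin {p : ℂ} (hp : 0 < p.re) (μ : ℝ) :
    (∫ θ in (0 : ℝ)..Real.pi, p / (p ^ 2 + ((μ * Real.sin θ : ℝ) : ℂ) ^ 2)) *
      (p ^ 2 + (μ : ℂ) ^ 2) ^ (1 / 2 : ℂ) = Real.pi := by
  have hp0 : p ≠ 0 := fun h => by simp [h] at hp
  have hne := fun y => Complex.sq_add_sq_ne_zero hp y
  set Q : ℝ → ℝ → ℂ := fun μ θ => p / (p ^ 2 + ((μ * Real.sin θ : ℝ) : ℂ) ^ 2) with hQ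
  set Q' : ℝ → ℝ → ℂ := fun μ θ =>
    -p * (2 * ((μ * Real.sin θ : ℝ) : ℂ) * (Real.sin θ : ℂ)) /
      (p ^ 2 + ((μ * Real.sin θ : ℝ) : ℂ) ^ 2) ^ 2 with hQ'
  have hQd : ∀ μ θ, HasDerivAt (fun μ => Q μ θ) (Q' μ θ) μ := by
    intro μ θ
    have h1 : HasDerivAt (fun μ : ℝ => ((μ * Real.sin θ : ℝ) : ℂ)) (Real.sin θ : ℂ) μ := by
      simpa using ((hasDerivAt_id μ).mul_const (Real.sin θ)).ofReal_comp
    have h2 := ((h1.pow 2).const_add (p ^ 2)).fun_inv (hne _)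
    convert! h2.const_mul p using 1
    simp only [hQ', Pi.pow_apply]
    push_cast
    ring
  have hQc : ∀ μ, Continuous (Q μ) := fun μ =>
    continuous_const.div (by fun_prop) fun θ => hne _
  have hQ'c : ∀ μ, Continuous (Q' μ) := fun μ =>
    Continuous.div (by fun_prop) (by fun_prop) fun θ => pow_ne_zero 2 (hne _)
  have hder : ∀ μ, HasDerivAt (fun μ => ∫ θ in (0 : ℝ)..Real.pi, Q μ θ)
      (∫ θ in (0 : ℝ)..Real.pi, Q' μ θ) μ := by
    intro μ
    refine (intervalIntegral.hasDerivAt_integral_of_dominated_loc_of_deriv_le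
      (bound := fun _ => ‖p‖ * (2 * (|μ| + 1)) / (p.re ^ 2) ^ 2)
      (Metric.ball_mem_nhds μ one_pos)
      (Filter.Eventually.of_forall fun ν => (hQc ν).aestronglyMeasurable)
      ((hQc μ).intervalIntegrable _ _) (hQ'c μ).aestronglyMeasurable
      (Filter.Eventually.of_forall fun θ _ ν hν => ?_) intervalIntegrable_const
      (Filter.Eventually.of_forall fun θ _ ν _ => hQd ν θ)).2
    have hν' : |ν| ≤ |μ| + 1 := by
      have : |ν - μ| < 1 := by simpa [Real.dist_eq] using hν
      have h3 : ν = μ + (ν - μ) := by ring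
      rw [h3]
      exact (abs_add_le _ _).trans (by linarith)
    simp only [hQ']
    rw [norm_div, norm_mul, norm_neg, norm_mul, norm_mul, norm_pow]
    have hs := Real.abs_sin_le_one θ
    simp only [Complex.norm_real, Real.norm_eq_abs, RCLike.norm_ofNat, abs_mul]
    refine div_le_div₀ (by positivity) ?_ (by positivity) ?_
    · gcongr ‖p‖ * ?_
      calc 2 * (|ν| * |Real.sin θ|) * |Real.sin θ| ≤ 2 * (|ν| * 1) * 1 := by gcongr
        _ ≤ 2 * (|μ| + 1) := by linarith
    · have := Complex.norm_sq_add_sq_ge hp (ν * Real.sin θ)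
      gcongr
  -- As a function of `μ` the integral satisfies `(p² + μ²) I' + μ I = 0`, so `I · (p² + μ²)^(1/2)`
  -- is constant and can be evaluated at `μ = 0`.
  have hode : ∀ μ : ℝ, (p ^ 2 + (μ : ℂ) ^ 2) * (∫ θ in (0 : ℝ)..Real.pi, Q' μ θ) +
      μ * ∫ θ in (0 : ℝ)..Real.pi, Q μ θ = 0 := by
    intro μ
    -- An explicit primitive in `θ` of the combination; its factor `sin θ` vanishes at `0` and `π`.
    have hprim : ∀ θ : ℝ, HasDerivAt (fun θ : ℝ => μ * p * ((Real.sin θ : ℂ) * (Real.cos θ : ℂ) /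
        (p ^ 2 + ((μ * Real.sin θ : ℝ) : ℂ) ^ 2)))
        ((p ^ 2 + (μ : ℂ) ^ 2) * Q' μ θ + μ * Q μ θ) θ := by
      intro θ
      have hs := (Real.hasDerivAt_sin θ).ofReal_comp
      have hc := (Real.hasDerivAt_cos θ).ofReal_comp
      have h1 := ((Real.hasDerivAt_sin θ).const_mul μ).ofReal_comp
      have h2 := (h1.pow 2).const_add (p ^ 2)
      convert! ((hs.mul hc).div h2 (hne _)).const_mul (μ * p) using 1
      have hD := hne (μ * Real.sin θ)
      have hsc : (Real.cos θ : ℂ) ^ 2 = 1 - (Real.sin θ : ℂ) ^ 2 := by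
        rw [eq_sub_iff_add_eq, add_comm]
        exact_mod_cast Real.sin_sq_add_cos_sq θ
      simp only [hQ, hQ']
      simp only [Complex.ofReal_mul, Complex.ofReal_neg] at hD ⊢
      simp only [Pi.pow_apply, Pi.mul_apply]
      generalize (Real.sin θ : ℂ) = s at *
      generalize (Real.cos θ : ℂ) = c at *
      field_simp
      push_cast
      congr 1
      linear_combination (-(μ : ℂ) * (p ^ 2 - (μ : ℂ) ^ 2 * s ^ 2)) * hsc
    rw [← intervalIntegral.integral_const_mul, ← intervalIntegral.integral_const_mul,
      ← intervalIntegral.integral_add, intervalIntegral.integral_eq_sub_of_hasDerivAt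
        (fun θ _ => hprim θ)]
    · simp
    · exact Continuous.intervalIntegrable
        ((continuous_const.mul (hQ'c μ)).add (continuous_const.mul (hQc μ))) _ _
    · exact Continuous.intervalIntegrable (continuous_const.mul (hQ'c μ)) _ _
    · exact Continuous.intervalIntegrable (continuous_const.mul (hQc μ)) _ _
  set W : ℝ → ℂ := fun μ => (p ^ 2 + (μ : ℂ) ^ 2) ^ (1 / 2 : ℂ) with hW
  have hW2 : ∀ μ, W μ ^ 2 = p ^ 2 + (μ : ℂ) ^ 2 := by
    intro μ
    rw [hW, ← Complex.cpow_nat_mul]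
    norm_num
  have hW0 : ∀ μ, W μ ≠ 0 := fun μ h => by
    have := hW2 μ
    rw [h] at this
    exact hne μ (by simpa using this.symm)
  have hWd : ∀ μ, HasDerivAt W (μ / W μ) μ := by
    intro μ
    have h2 := ((((hasDerivAt_id (μ : ℂ)).pow 2).const_add (p ^ 2)).cpow_const (c := (1 / 2 : ℂ))
      (Complex.sq_add_sq_mem_slitPlane hp μ)).comp_ofReal
    convert! h2 using 1
    have h3 : (p ^ 2 + (μ : ℂ) ^ 2) ^ (1 / 2 - 1 : ℂ) = (W μ)⁻¹ := by
      rw [hW, ← Complex.cpow_neg]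
      norm_num
    simp only [Pi.pow_apply, id_eq]
    rw [h3]
    push_cast
    ring
  have hconst : ∀ μ, HasDerivAt (fun μ => (∫ θ in (0 : ℝ)..Real.pi, Q μ θ) * W μ) 0 μ := by
    intro μ
    convert! (hder μ).mul (hWd μ) using 1
    have := hode μ
    rw [← hW2] at this
    have h0 := hW0 μ
    field_simp
    linear_combination -this
  have h := is_const_of_deriv_eq_zero (fun μ => (hconst μ).differentiableAt)
    (fun μ => (hconst μ).deriv) μ 0
  refine h.trans ?_
  -- The principal root of `p²` is `p` and not `-p` because `Re p > 0`.
  have hW00 : W 0 = p := by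
    simp only [hW, Complex.ofReal_zero, ne_eq, OfNat.ofNat_ne_zero, not_false_eq_true, zero_pow,
      add_zero]
    have hre := Complex.abs_arg_lt_pi_div_two_iff.2 (Or.inl hp)
    rw [abs_lt] at hre
    have := Complex.pow_cpow_nat_inv (n := 2) two_ne_zero (x := p)
      (by push_cast; linarith [hre.1]) (by push_cast; linarith [hre.2])
    simpa using this
  rw [hW00]
  simp only [hQ]
  simp
  field_simp

theorem integral_exp_neg_mul_cos {p : ℂ} (hp : 0 < p.re) (y : ℝ) :
    ∫ x in Set.Ioi (0 : ℝ), Complex.exp (-p * x) * (Real.cos (y * x) : ℂ) =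
      p / (p ^ 2 + (y : ℂ) ^ 2) := by
  have hre : ∀ s : ℝ, (-p + s * Complex.I).re < 0 := fun s => by simpa using hp
  have e : ∀ x : ℝ, Complex.exp (-p * x) * (Real.cos (y * x) : ℂ) =
      1 / 2 * Complex.exp ((-p + y * Complex.I) * x) +
      1 / 2 * Complex.exp ((-p + (-y : ℝ) * Complex.I) * x) := by
    intro x
    rw [add_mul, add_mul, Complex.exp_add, Complex.exp_add, Complex.ofReal_cos, Complex.cos]
    have h1 : ((y * x : ℝ) : ℂ) * Complex.I = y * Complex.I * x := by push_cast; ring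
    have h2 : -((y * x : ℝ) : ℂ) * Complex.I = (-y : ℝ) * Complex.I * x := by push_cast; ring
    rw [h1, h2]
    ring
  simp_rw [e]
  rw [MeasureTheory.integral_add
    ((integrableOn_exp_mul_complex_Ioi (hre y) 0).const_mul _)
    ((integrableOn_exp_mul_complex_Ioi (hre (-y)) 0).const_mul _),
    MeasureTheory.integral_const_mul, MeasureTheory.integral_const_mul,
    integral_exp_mul_complex_Ioi (hre y), integral_exp_mul_complex_Ioi (hre (-y))]
  have h0 := Complex.sq_add_sq_ne_zero hp y
  have hn : ∀ s : ℝ, -p + s * Complex.I ≠ 0 := fun s h => by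
    have := hre s
    rw [h] at this
    simp at this
  have h1 := hn y
  have h2 : -p - y * Complex.I ≠ 0 := by simpa [sub_eq_add_neg] using hn (-y)
  have h3 : p ^ 2 + (y : ℂ) ^ 2 = (-p + y * Complex.I) * (-p - y * Complex.I) := by
    linear_combination (y : ℂ) ^ 2 * Complex.I_sq
  rw [h3, show -p + (-y : ℝ) * Complex.I = -p - y * Complex.I by push_cast; ring]
  simp only [Complex.ofReal_zero, mul_zero, Complex.exp_zero]
  field_simp
  ring

/-- The Laplace transform of `J₀`. -/
theorem integral_exp_neg_mul_besselJ_zero {p : ℂ} (hp : 0 < p.re) (μ : ℝ) :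
    ∫ x in Set.Ioi (0 : ℝ), Complex.exp (-p * x) * (besselJ 0 (μ * x) : ℂ) =
      ((p ^ 2 + (μ : ℂ) ^ 2) ^ (1 / 2 : ℂ))⁻¹ := by
  have hpi : (Real.pi : ℂ) ≠ 0 := by exact_mod_cast Real.pi_ne_zero
  have hJ : ∀ x : ℝ, Complex.exp (-p * x) * (besselJ 0 (μ * x) : ℂ) = 1 / Real.pi *
      ∫ θ in (0 : ℝ)..Real.pi, Complex.exp (-p * x) * (Real.cos ((μ * Real.sin θ) * x) : ℂ) := by
    intro x
    rw [besselJ_zero_eq_integral, intervalIntegral.integral_const_mul,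
      intervalIntegral.integral_ofReal]
    simp_rw [show ∀ θ : ℝ, μ * Real.sin θ * x = μ * x * Real.sin θ from fun θ => by ring]
    push_cast
    ring
  simp_rw [hJ]
  -- Fubini is justified by the bound `exp(-Re p · x)` on `(0, π] × (0, ∞)`.
  rw [MeasureTheory.integral_const_mul, ← MeasureTheory.intervalIntegral_integral_swap]
  · have h := integral_div_sq_add_sq_sin hp μ
    simp_rw [integral_exp_neg_mul_cos hp]
    refine eq_inv_of_mul_eq_one_left ?_
    rw [mul_assoc, h]
    field_simp
  · have hg : MeasureTheory.Integrable (fun z : ℝ × ℝ => (1 : ℝ) * Real.exp (-p.re * z.2))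
        ((MeasureTheory.volume.restrict (Set.uIoc 0 Real.pi)).prod
          (MeasureTheory.volume.restrict (Set.Ioi 0))) :=
      MeasureTheory.Integrable.mul_prod (f := fun _ => (1 : ℝ))
        (show MeasureTheory.IntegrableOn (fun _ => (1 : ℝ)) (Set.uIoc 0 Real.pi) from
          intervalIntegrable_iff.1 intervalIntegrable_const) (integrableOn_exp_mul_Ioi (neg_lt_zero.2 hp) 0)
    refine hg.mono' (Continuous.aestronglyMeasurable (by fun_prop))
      (Filter.Eventually.of_forall fun z => ?_)
    simp only [Function.uncurry]
    rw [norm_mul, Complex.norm_exp, mul_comm, Complex.norm_real]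
    refine mul_le_mul (Real.abs_cos_le_one _) (le_of_eq ?_) (Real.exp_pos _).le zero_le_one
    simp

/-! ### Orthogonality of odd functions to `J₀(lam x)`. -/

open scoped FourierTransform

theorem continuous_fourier_of_integrable {g : ℝ → ℂ} (hg : MeasureTheory.Integrable g) :
    Continuous (𝓕 g) :=
  VectorFourier.fourierIntegral_continuous Real.continuous_fourierChar
    (by exact continuous_inner) hg

namespace DecayingExpType

variable {a : ℝ} {f : ℂ → ℂ}

theorem integrable_fourier (ha : 0 ≤ a) (hf : DecayingExpType a f) :
    MeasureTheory.Integrable (𝓕 fun x : ℝ => f x) := by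
  refine (continuous_fourier_of_integrable hf.integrable).integrable_of_hasCompactSupport ?_
  refine HasCompactSupport.intro (isCompact_Icc (a := -(a / (2 * Real.pi)))
    (b := a / (2 * Real.pi))) fun ξ hξ => hf.fourier_eq_zero ha ?_
  by_contra! h
  refine hξ ?_
  have hpi := Real.pi_pos
  rw [abs_mul, abs_of_pos (by positivity : 0 < 2 * Real.pi), mul_comm,
    ← le_div_iff₀ (by positivity)] at h
  exact abs_le.1 h

theorem eq_integral_fourier (ha : 0 ≤ a) (hf : DecayingExpType a f) (x : ℝ) :
    f x = ∫ ξ : ℝ, Complex.exp ((2 * Real.pi * ξ * x : ℝ) * Complex.I) *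
      𝓕 (fun x : ℝ => f x) ξ := by
  have h := congrFun (hf.continuous_ofReal.fourierInv_fourier_eq hf.integrable
    (hf.integrable_fourier ha)) x
  rw [← h, Real.fourierInv_eq']
  congr 1 with ξ
  rw [smul_eq_mul]
  simp [mul_assoc, mul_comm x ξ]

theorem fourier_odd (hodd : ∀ z, f (-z) = -f z) (ξ : ℝ) :
    𝓕 (fun x : ℝ => f x) (-ξ) = -𝓕 (fun x : ℝ => f x) ξ := by
  rw [Real.fourier_real_eq_integral_exp_smul, Real.fourier_real_eq_integral_exp_smul,
    ← MeasureTheory.integral_neg, ← MeasureTheory.integral_neg_eq_self]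
  congr 1 with x
  rw [Complex.ofReal_neg, hodd, smul_neg]
  congr 4
  push_cast
  ring

/-- Insert Fourier inversion for `f` and exchange the integrals: the inner one is the Laplace
transform of `J₀` at `ε - 2πiξ`. The Abel factor `exp(-εx)` makes the double integral absolutely
convergent. -/
theorem integral_exp_mul_besselJ_zero (ha : 0 ≤ a) (hf : DecayingExpType a f) {ε : ℝ}
    (hε : 0 < ε) (lam : ℝ) :
    ∫ x in Set.Ioi (0 : ℝ), Complex.exp (-ε * x) * (f x * (besselJ 0 (lam * x) : ℂ)) =
      ∫ ξ : ℝ, 𝓕 (fun x : ℝ => f x) ξ *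
        (((ε - (2 * Real.pi * ξ : ℝ) * Complex.I) ^ 2 + (lam : ℂ) ^ 2) ^ (1 / 2 : ℂ))⁻¹ := by
  set g := 𝓕 (fun x : ℝ => f x) with hg
  have hgi : MeasureTheory.Integrable g := hf.integrable_fourier ha
  have hre : ∀ ξ : ℝ, 0 < (ε - (2 * Real.pi * ξ : ℝ) * Complex.I : ℂ).re := fun ξ => by
    simpa using hε
  simp_rw [← fun ξ => integral_exp_neg_mul_besselJ_zero (hre ξ) lam,
    ← MeasureTheory.integral_const_mul]
  rw [← MeasureTheory.integral_integral_swap]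
  · congr 1 with x
    rw [hf.eq_integral_fourier ha, ← MeasureTheory.integral_mul_const,
      ← MeasureTheory.integral_const_mul]
    congr 1 with ξ
    have : Complex.exp (-(ε - (2 * Real.pi * ξ : ℝ) * Complex.I) * x) =
      Complex.exp (-ε * x) * Complex.exp ((2 * Real.pi * ξ * x : ℝ) * Complex.I) := by
      rw [← Complex.exp_add]
      congr 1
      push_cast
      ring
    rw [this]
    ring
  · have hb : MeasureTheory.Integrable (fun z : ℝ × ℝ => Real.exp (-ε * z.1) * ‖g z.2‖)
        ((MeasureTheory.volume.restrict (Set.Ioi 0)).prod MeasureTheory.volume) :=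
      MeasureTheory.Integrable.mul_prod (integrableOn_exp_mul_Ioi (neg_lt_zero.2 hε) 0) hgi.norm
    have hgc : Continuous g := continuous_fourier_of_integrable hf.integrable
    have hJ := continuous_besselJ 0
    refine hb.mono' (Continuous.aestronglyMeasurable (by unfold Function.uncurry; fun_prop))
      (Filter.Eventually.of_forall fun z => ?_)
    simp only [Function.uncurry]
    rw [norm_mul, norm_mul, Complex.norm_exp, Complex.norm_real, mul_comm]
    have h1 : (-(ε - (2 * Real.pi * z.2 : ℝ) * Complex.I) * z.1 : ℂ).re = -ε * z.1 := by simp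
    rw [h1]
    gcongr
    exact mul_le_of_le_one_right (Real.exp_pos _).le (abs_besselJ_zero_le_one _)

theorem integrable_mul_besselJ (hf : DecayingExpType a f) {lam : ℝ} (hlam : 0 ≤ lam) (n : ℕ) :
    MeasureTheory.IntegrableOn (fun x : ℝ => f x * (besselJ n (lam * x) : ℂ)) (Set.Ioi 0) := by
  obtain ⟨B, -, hB⟩ := exists_abs_besselJ_le_const n
  have hJ := continuous_besselJ n
  refine hf.integrable.integrableOn.mul_bdd (c := B)
    (Continuous.aestronglyMeasurable (by fun_prop)) ?_
  refine (MeasureTheory.ae_restrict_mem measurableSet_Ioi).mono fun x hx => ?_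
  rw [Complex.norm_real]
  exact hB _ (mul_nonneg hlam (le_of_lt hx))

/-- Odd functions of exponential type smaller than `lam` are orthogonal to `J₀(lam ·)`. -/
theorem integral_mul_besselJ_zero_of_odd (ha : 0 ≤ a) (hf : DecayingExpType a f)
    (hodd : ∀ z, f (-z) = -f z) {lam : ℝ} (hlam : a < lam) :
    ∫ x in Set.Ioi (0 : ℝ), f x * (besselJ 0 (lam * x) : ℂ) = 0 := by
  have hlam0 : 0 ≤ lam := ha.trans hlam.le
  set g := 𝓕 (fun x : ℝ => f x) with hg
  have hgi : MeasureTheory.Integrable g := hf.integrable_fourier ha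
  have hgc : Continuous g := continuous_fourier_of_integrable hf.integrable
  set V : ℝ → ℝ → ℂ := fun ε ξ => (ε - (2 * Real.pi * ξ : ℝ) * Complex.I) ^ 2 + (lam : ℂ) ^ 2
    with hV
  -- On the support of `g` the quantity under the root has real part at least `lam² - a² > 0`,
  -- uniformly in `ε`. This gives continuity of the principal root at `ε = 0` and a dominating
  -- function; here `a < lam` is essential.
  have hVre : ∀ ε ξ, |2 * Real.pi * ξ| ≤ a → lam ^ 2 - a ^ 2 ≤ (V ε ξ).re := by
    intro ε ξ h
    have h1 : (V ε ξ).re = ε ^ 2 - (2 * Real.pi * ξ) ^ 2 + lam ^ 2 := by simp [hV, sq]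
    have h2 := sq_le_sq' (by linarith [abs_le.1 h |>.1]) (abs_le.1 h |>.2)
    rw [h1]
    nlinarith [sq_nonneg ε]
  have hd : 0 < lam ^ 2 - a ^ 2 := by nlinarith
  have hVslit : ∀ ε ξ, |2 * Real.pi * ξ| ≤ a → V ε ξ ∈ Complex.slitPlane := fun ε ξ h =>
    Complex.mem_slitPlane_iff.2 (Or.inl (hd.trans_le (hVre ε ξ h)))
  have hleft : Filter.Tendsto (fun ε : ℝ => ∫ x in Set.Ioi (0 : ℝ),
      Complex.exp (-ε * x) * (f x * (besselJ 0 (lam * x) : ℂ))) (nhdsWithin 0 (Set.Ioi 0))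
      (nhds (∫ x in Set.Ioi (0 : ℝ), f x * (besselJ 0 (lam * x) : ℂ))) := by
    have hi := hf.integrable_mul_besselJ hlam0 0
    refine MeasureTheory.tendsto_integral_filter_of_dominated_convergence
      (fun x : ℝ => ‖f x * (besselJ 0 (lam * x) : ℂ)‖) (Filter.Eventually.of_forall fun ε => ?_)
      ?_ hi.norm (Filter.Eventually.of_forall fun x => ?_)
    · exact (Continuous.aestronglyMeasurable (by fun_prop)).mul hi.aestronglyMeasurable
    · filter_upwards [self_mem_nhdsWithin] with ε hε
      refine (MeasureTheory.ae_restrict_mem measurableSet_Ioi).mono fun x hx => ?_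
      rw [norm_mul]
      refine mul_le_of_le_one_left (norm_nonneg _) ?_
      rw [Complex.norm_exp, Real.exp_le_one_iff]
      have : 0 ≤ ε * x := mul_nonneg (le_of_lt hε) (le_of_lt hx)
      simpa using this
    · have h1 : Filter.Tendsto (fun ε : ℝ => Complex.exp (-ε * x) *
          (f x * (besselJ 0 (lam * x) : ℂ))) (nhds 0)
          (nhds (Complex.exp (-(0 : ℝ) * x) * (f x * (besselJ 0 (lam * x) : ℂ)))) :=
        Continuous.tendsto (by fun_prop) 0
      simpa using h1.mono_left nhdsWithin_le_nhds
  have hright : Filter.Tendsto (fun ε : ℝ => ∫ ξ : ℝ, g ξ * (V ε ξ ^ (1 / 2 : ℂ))⁻¹)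
      (nhdsWithin 0 (Set.Ioi 0)) (nhds (∫ ξ : ℝ, g ξ * (V 0 ξ ^ (1 / 2 : ℂ))⁻¹)) := by
    refine MeasureTheory.tendsto_integral_filter_of_dominated_convergence
      (fun ξ : ℝ => ‖g ξ‖ * ((lam ^ 2 - a ^ 2) ^ (1 / 2 : ℝ))⁻¹)
      (Filter.Eventually.of_forall fun ε => ?_)
      (Filter.Eventually.of_forall fun ε => Filter.Eventually.of_forall fun ξ => ?_)
      (hgi.norm.mul_const _) (Filter.Eventually.of_forall fun ξ => ?_)
    · refine hgc.aestronglyMeasurable.mul (Measurable.aestronglyMeasurable ?_)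
      have : Continuous (V ε) := by fun_prop
      exact (this.measurable.pow_const _).inv
    · rcases le_or_gt |2 * Real.pi * ξ| a with h | h
      · rw [norm_mul, norm_inv]
        have e : (1 / 2 : ℂ) = ((1 / 2 : ℝ) : ℂ) := by push_cast; rfl
        rw [e, Complex.norm_cpow_real]
        have := (hVre ε ξ h).trans (Complex.re_le_norm _)
        gcongr
      · rw [hg, hf.fourier_eq_zero ha h]
        simp
    · rcases le_or_gt |2 * Real.pi * ξ| a with h | h
      · refine Filter.Tendsto.const_mul _ (Filter.Tendsto.inv₀ ?_ ?_)
        · have h1 : Filter.Tendsto (fun ε => V ε ξ) (nhds 0) (nhds (V 0 ξ)) :=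
            Continuous.tendsto (by fun_prop) 0
          exact (h1.mono_left nhdsWithin_le_nhds).cpow tendsto_const_nhds (hVslit 0 ξ h)
        · rw [Complex.cpow_ne_zero_iff_of_exponent_ne_zero (by norm_num)]
          exact Complex.slitPlane_ne_zero (hVslit 0 ξ h)
      · rw [hg, hf.fourier_eq_zero ha h]
        simp
  -- At `ε = 0` the root is even in `ξ`, while `g` is odd.
  have hzero : ∫ ξ : ℝ, g ξ * (V 0 ξ ^ (1 / 2 : ℂ))⁻¹ = 0 := by
    have h1 := MeasureTheory.integral_neg_eq_self
      (fun ξ : ℝ => g ξ * (V 0 ξ ^ (1 / 2 : ℂ))⁻¹) MeasureTheory.volume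
    have h2 : ∀ ξ, g (-ξ) * (V 0 (-ξ) ^ (1 / 2 : ℂ))⁻¹ = -(g ξ * (V 0 ξ ^ (1 / 2 : ℂ))⁻¹) := by
      intro ξ
      have e : V 0 (-ξ) = V 0 ξ := by simp [hV, mul_pow]
      rw [e, hg, fourier_odd hodd, neg_mul]
    simp_rw [h2] at h1
    rw [MeasureTheory.integral_neg] at h1
    exact CharZero.eq_neg_self_iff.1 h1.symm
  rw [← hzero]
  refine tendsto_nhds_unique hleft (hright.congr' ?_)
  filter_upwards [self_mem_nhdsWithin] with ε hε
  exact (hf.integral_exp_mul_besselJ_zero ha hε lam).symm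

end DecayingExpType

/-! ### Descent in the order of the Bessel function. -/

/-- The polynomial `∑ C(i, j) u (i - j)` over `i + j = n` satisfies a Fibonacci-type recurrence. -/
theorem sum_antidiagonal_choose_smul_succ_succ (u : ℕ → ℂ) (n : ℕ) :
    ∑ p ∈ Finset.HasAntidiagonal.antidiagonal (n + 2), (p.1.choose p.2 : ℂ) * u (p.1 - p.2) =
      ∑ p ∈ Finset.HasAntidiagonal.antidiagonal n, (p.1.choose p.2 : ℂ) * u (p.1 - p.2) +
      ∑ p ∈ Finset.HasAntidiagonal.antidiagonal (n + 1), (p.1.choose p.2 : ℂ) * u (p.1 - p.2 + 1) := by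
  rw [Finset.Nat.sum_antidiagonal_succ, Finset.Nat.sum_antidiagonal_succ',
    Finset.Nat.sum_antidiagonal_succ', ← add_assoc, add_comm (Finset.sum _ _), add_assoc]
  simp only [Nat.choose_zero_succ, Nat.cast_zero, zero_mul, zero_add, Nat.choose_zero_right,
    Nat.cast_one, one_mul, Nat.sub_zero]
  have : ∀ p : ℕ × ℕ, ((p.1 + 1).choose (p.2 + 1) : ℂ) * u (p.1 + 1 - (p.2 + 1)) =
      (p.1.choose p.2 : ℂ) * u (p.1 - p.2) +
      (p.1.choose (p.2 + 1) : ℂ) * u (p.1 - (p.2 + 1) + 1) := by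
    intro p
    rw [Nat.choose_succ_succ, Nat.add_sub_add_right]
    -- Where the natural subtraction truncates, the binomial coefficient is zero.
    rcases Nat.lt_or_ge p.1 (p.2 + 1) with h | h
    · rw [Nat.choose_eq_zero_of_lt h]
      push_cast
      ring
    · rw [show p.1 - (p.2 + 1) + 1 = p.1 - p.2 by omega]
      push_cast
      ring
  simp_rw [this]
  rw [Finset.sum_add_distrib]
  ring

theorem sum_antidiagonal_choose_two_mul (u : ℕ → ℂ) (l : ℕ) :
    ∑ p ∈ Finset.HasAntidiagonal.antidiagonal (2 * l), (p.1.choose p.2 : ℂ) * u (p.1 - p.2) =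
      ∑ i ∈ Finset.range (l + 1), ((l + i).choose (l - i) : ℂ) * u (2 * i) := by
  rw [← Finset.Nat.sum_antidiagonal_swap, Finset.Nat.sum_antidiagonal_eq_sum_range_succ_mk]
  simp only [Prod.swap_prod_mk]
  -- Terms with `j > l` vanish, since then `2l - j < j`; the others are reindexed by `j = l - i`.
  rw [← Finset.sum_subset (s₁ := Finset.range (l + 1))
    (Finset.range_subset_range.2 (by omega)) (fun j hj hj' => ?_), ← Finset.sum_range_reflect]
  · refine Finset.sum_congr rfl fun i hi => ?_
    have hi' : i ≤ l := Nat.lt_succ_iff.1 (Finset.mem_range.1 hi)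
    rw [show l + 1 - 1 - i = l - i by omega, show 2 * l - (l - i) = l + i by omega,
      show l + i - (l - i) = 2 * i by omega]
  · rw [Nat.choose_eq_zero_of_lt (by simp at hj'; omega)]
    simp

namespace DecayingExpType

variable {a : ℝ} {f : ℂ → ℂ}

theorem deriv_parity (hf : DecayingExpType a f) {n : ℕ}
    (hpar : ∀ z, f (-z) = (-1) ^ n * f z) (z : ℂ) :
    _root_.deriv f (-z) = (-1) ^ (n + 1) * _root_.deriv f z := by
  have h1 : _root_.deriv (fun w => f (-w)) z = -_root_.deriv f (-z) := deriv_comp_neg f z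
  have h2 : (fun w => f (-w)) = fun w => (-1) ^ n * f w := funext hpar
  rw [h2, deriv_const_mul _ hf.differentiable.differentiableAt] at h1
  rw [pow_succ]
  linear_combination h1

theorem hasDerivAt_ofReal (hf : DecayingExpType a f) (x : ℝ) :
    HasDerivAt (fun x : ℝ => f x) (_root_.deriv f x) x :=
  (hf.differentiable.differentiableAt.hasDerivAt).comp_ofReal

theorem tendsto_mul_besselJ (hf : DecayingExpType a f) {lam : ℝ} (hlam : 0 ≤ lam) (n : ℕ) :
    Filter.Tendsto (fun x : ℝ => f x * (besselJ n (lam * x) : ℂ)) Filter.atTop (nhds 0) := by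
  obtain ⟨B, -, hB⟩ := exists_abs_besselJ_le_const n
  refine squeeze_zero_norm' (a := fun x : ℝ => ‖f x‖ * B) ?_ ?_
  · filter_upwards [Filter.eventually_ge_atTop 0] with x hx
    rw [norm_mul, Complex.norm_real]
    gcongr
    exact hB _ (mul_nonneg hlam hx)
  · simpa using hf.tendsto_zero.norm.mul_const B

theorem tendsto_mul_besselJ_zero (hf : DecayingExpType a f) (lam : ℝ) (n : ℕ) :
    Filter.Tendsto (fun x : ℝ => f x * (besselJ n (lam * x) : ℂ)) (nhdsWithin 0 (Set.Ioi 0))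
      (nhds (f 0 * (besselJ n 0 : ℂ))) := by
  have h1 := hf.continuous_ofReal
  have h2 := continuous_besselJ n
  have h : Continuous fun x : ℝ => f x * (besselJ n (lam * x) : ℂ) :=
    h1.mul (by fun_prop)
  simpa using (h.tendsto 0).mono_left nhdsWithin_le_nhds

theorem integral_mul_besselJ_one (ha : 0 ≤ a) (hf : DecayingExpType a f) {lam : ℝ}
    (hlam : 0 < lam) :
    ∫ x in Set.Ioi (0 : ℝ), f x * (besselJ 1 (lam * x) : ℂ) =
      1 / lam * (f 0 +
        ∫ x in Set.Ioi (0 : ℝ), _root_.deriv f x * (besselJ 0 (lam * x) : ℂ)) := by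
  have hv : ∀ x : ℝ, HasDerivAt (fun x : ℝ => (besselJ 0 (lam * x) : ℂ))
      (-lam * (besselJ 1 (lam * x) : ℂ)) x := by
    intro x
    have := ((hasDerivAt_besselJ_zero (lam * x)).comp x
      ((hasDerivAt_id x).const_mul lam)).ofReal_comp
    convert! this using 1
    push_cast
    ring
  have hi := (hf.integrable_mul_besselJ hlam.le 1).const_mul (-lam : ℂ)
  have h := MeasureTheory.integral_Ioi_mul_deriv_eq_deriv_mul (a := 0)
    (u := fun x : ℝ => f x) (u' := fun x : ℝ => _root_.deriv f x)
    (v := fun x : ℝ => (besselJ 0 (lam * x) : ℂ))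
    (v' := fun x : ℝ => -lam * (besselJ 1 (lam * x) : ℂ))
    (fun x _ => hf.hasDerivAt_ofReal x) (fun x _ => hv x)
    (by
      refine MeasureTheory.Integrable.congr hi (Filter.Eventually.of_forall fun x => ?_)
      simp only [Pi.mul_apply]
      ring)
    ((hf.deriv ha).integrable_mul_besselJ hlam.le 0)
    (hf.tendsto_mul_besselJ_zero lam 0) (hf.tendsto_mul_besselJ hlam.le 0)
  have e : ∫ x in Set.Ioi (0 : ℝ), f x * (-lam * (besselJ 1 (lam * x) : ℂ)) =
      -lam * ∫ x in Set.Ioi (0 : ℝ), f x * (besselJ 1 (lam * x) : ℂ) := by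
    rw [← MeasureTheory.integral_const_mul]
    congr 1 with x
    ring
  rw [e, besselJ_zero_zero] at h
  have hl : (lam : ℂ) ≠ 0 := by exact_mod_cast hlam.ne'
  rw [div_mul_eq_mul_div, one_mul, eq_div_iff hl]
  push_cast at h
  linear_combination -h

/-- Integration by parts against `J_{n+1}(lam x)`. There is no boundary term, as `J_{n+1}(0) = 0`;
only the descent from `J₁` to `J₀` produces one. -/
theorem integral_mul_besselJ_add_two (ha : 0 ≤ a) (hf : DecayingExpType a f) {lam : ℝ}
    (hlam : 0 < lam) (n : ℕ) :
    ∫ x in Set.Ioi (0 : ℝ), f x * (besselJ (n + 2) (lam * x) : ℂ) =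
      (∫ x in Set.Ioi (0 : ℝ), f x * (besselJ n (lam * x) : ℂ)) +
      2 / lam * ∫ x in Set.Ioi (0 : ℝ), _root_.deriv f x * (besselJ (n + 1) (lam * x) : ℂ) := by
  have hv : ∀ x : ℝ, HasDerivAt (fun x : ℝ => (besselJ (n + 1) (lam * x) : ℂ))
      (lam / 2 * ((besselJ n (lam * x) : ℂ) - (besselJ (n + 2) (lam * x) : ℂ))) x := by
    intro x
    have := ((hasDerivAt_besselJ_succ n (lam * x)).comp x
      ((hasDerivAt_id x).const_mul lam)).ofReal_comp
    convert! this using 1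
    push_cast
    ring
  have hi1 := hf.integrable_mul_besselJ hlam.le n
  have hi2 := hf.integrable_mul_besselJ hlam.le (n + 2)
  have h := MeasureTheory.integral_Ioi_mul_deriv_eq_deriv_mul (a := 0)
    (u := fun x : ℝ => f x) (u' := fun x : ℝ => _root_.deriv f x)
    (v := fun x : ℝ => (besselJ (n + 1) (lam * x) : ℂ))
    (v' := fun x : ℝ =>
      lam / 2 * ((besselJ n (lam * x) : ℂ) - (besselJ (n + 2) (lam * x) : ℂ)))
    (fun x _ => hf.hasDerivAt_ofReal x) (fun x _ => hv x)
    (by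
      refine MeasureTheory.Integrable.congr ((hi1.sub hi2).const_mul (lam / 2 : ℂ))
        (Filter.Eventually.of_forall fun x => ?_)
      simp only [Pi.mul_apply, Pi.sub_apply]
      ring)
    ((hf.deriv ha).integrable_mul_besselJ hlam.le (n + 1))
    (hf.tendsto_mul_besselJ_zero lam (n + 1)) (hf.tendsto_mul_besselJ hlam.le (n + 1))
  have e : ∫ x in Set.Ioi (0 : ℝ),
      f x * (lam / 2 * ((besselJ n (lam * x) : ℂ) - (besselJ (n + 2) (lam * x) : ℂ))) =
      lam / 2 * ((∫ x in Set.Ioi (0 : ℝ), f x * (besselJ n (lam * x) : ℂ)) -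
        ∫ x in Set.Ioi (0 : ℝ), f x * (besselJ (n + 2) (lam * x) : ℂ)) := by
    rw [← MeasureTheory.integral_sub hi1 hi2, ← MeasureTheory.integral_const_mul]
    congr 1 with x
    ring
  rw [e, besselJ_succ_zero] at h
  have hl : (lam : ℂ) ≠ 0 := by exact_mod_cast hlam.ne'
  push_cast at h
  have h' : ∫ x in Set.Ioi (0 : ℝ), _root_.deriv f x * (besselJ (n + 1) (lam * x) : ℂ) =
      -(lam / 2 * ((∫ x in Set.Ioi (0 : ℝ), f x * (besselJ n (lam * x) : ℂ)) -
        ∫ x in Set.Ioi (0 : ℝ), f x * (besselJ (n + 2) (lam * x) : ℂ))) := by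
    linear_combination h
  rw [h']
  field_simp
  ring

/-- The parity of `f` is tied to `n` so that whatever finally meets `J₀` is odd and drops out. The
descent obeys the same Fibonacci-type recurrence as the binomial sum. The function varies in the
induction because the step also uses `f'`. -/
theorem integral_mul_besselJ_succ (ha : 0 ≤ a) {lam : ℝ} (hlam : a < lam) (n : ℕ) :
    ∀ {f : ℂ → ℂ}, DecayingExpType a f → (∀ z, f (-z) = (-1) ^ n * f z) →
    ∫ x in Set.Ioi (0 : ℝ), f x * (besselJ (n + 1) (lam * x) : ℂ) =
      1 / lam * ∑ p ∈ Finset.HasAntidiagonal.antidiagonal n, (p.1.choose p.2 : ℂ) *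
        ((2 / lam) ^ (p.1 - p.2) * iteratedDeriv (p.1 - p.2) f 0) := by
  have hlam0 : 0 < lam := ha.trans_lt hlam
  induction n using Nat.twoStepInduction with
  | zero =>
    intro f hf hpar
    rw [zero_add, hf.integral_mul_besselJ_one ha hlam0,
      (hf.deriv ha).integral_mul_besselJ_zero_of_odd ha
        (fun z => by simpa using hf.deriv_parity hpar z) hlam]
    simp
  | one =>
    intro f hf hpar
    rw [hf.integral_mul_besselJ_add_two ha hlam0 0,
      hf.integral_mul_besselJ_zero_of_odd ha (fun z => by simpa using hpar z) hlam,
      (hf.deriv ha).integral_mul_besselJ_one ha hlam0,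
      (((hf.deriv ha).deriv ha)).integral_mul_besselJ_zero_of_odd ha
        (fun z => by
          simpa [pow_succ] using (hf.deriv ha).deriv_parity (hf.deriv_parity hpar) z) hlam]
    simp [Finset.Nat.antidiagonal_succ, iteratedDeriv_one]
    ring
  | more n ih1 ih2 =>
    intro f hf hpar
    rw [hf.integral_mul_besselJ_add_two ha hlam0 (n + 1),
      ih1 hf (fun z => by rw [hpar, pow_add]; simp),
      ih2 (hf.deriv ha) (fun z => by rw [hf.deriv_parity hpar, pow_add _ (n + 1) 2]; simp),
      sum_antidiagonal_choose_smul_succ_succ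
        (fun k => (2 / (lam : ℂ)) ^ k * iteratedDeriv k f 0) n, mul_add, add_right_inj,
      ← mul_assoc, mul_comm (2 / (lam : ℂ)), mul_assoc, Finset.mul_sum]
    congr 1
    refine Finset.sum_congr rfl fun p _ => ?_
    rw [iteratedDeriv_succ', pow_succ]
    ring

theorem integral_mul_besselJ_two_mul_add_one (ha : 0 ≤ a) {lam : ℝ} (hlam : a < lam) (l : ℕ)
    (hf : DecayingExpType a f) (heven : ∀ z, f (-z) = f z) :
    ∫ x in Set.Ioi (0 : ℝ), f x * (besselJ (2 * l + 1) (lam * x) : ℂ) =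
      1 / lam * ∑ i ∈ Finset.range (l + 1), ((l + i).choose (l - i) : ℂ) *
        ((2 / lam) ^ (2 * i) * iteratedDeriv (2 * i) f 0) := by
  rw [integral_mul_besselJ_succ ha hlam (2 * l) hf (fun z => by simp [heven]),
    sum_antidiagonal_choose_two_mul (fun k => (2 / (lam : ℂ)) ^ k * iteratedDeriv k f 0)]

end DecayingExpType

/-! ### Growth of `1 / (Γ(a + w) Γ(a - w))`. -/

theorem Complex.norm_sin_le_exp_abs_im (z : ℂ) : ‖sin z‖ ≤ Real.exp |z.im| := by
  have h1 : ‖exp (-z * I)‖ ≤ Real.exp |z.im| := by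
    rw [norm_exp]
    gcongr
    simpa using le_abs_self z.im
  have h2 : ‖exp (z * I)‖ ≤ Real.exp |z.im| := by
    rw [norm_exp]
    gcongr
    simpa using neg_le_abs z.im
  rw [sin, norm_div, norm_mul, norm_I, mul_one, RCLike.norm_ofNat, div_le_iff₀ two_pos]
  refine (norm_sub_le _ _).trans ?_
  linarith

theorem Complex.norm_Gamma_le_of_one_le {z : ℂ} (hz : ∀ j : ℕ, 1 ≤ ‖z + j‖) (n : ℕ) :
    ‖Gamma z‖ ≤ ‖Gamma (z + n)‖ := by
  induction n with
  | zero => simp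
  | succ n ih =>
    have h0 : z + n ≠ 0 := fun h => by
      have := hz n
      rw [h, norm_zero] at this
      linarith
    rw [show z + ((n + 1 : ℕ) : ℂ) = z + n + 1 by push_cast; ring, Gamma_add_one _ h0, norm_mul]
    exact ih.trans (le_mul_of_one_le_left (norm_nonneg _) (hz n))

theorem Complex.norm_inv_Gamma_le (z : ℂ) (n : ℕ) :
    ‖(Gamma z)⁻¹‖ ≤ (‖z‖ + n) ^ n * ‖(Gamma (z + n))⁻¹‖ := by
  induction n with
  | zero => simp
  | succ n ih =>
    refine ih.trans ?_
    rw [one_div_Gamma_eq_self_mul_one_div_Gamma_add_one (z + n), norm_mul,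
      show z + ((n + 1 : ℕ) : ℂ) = z + n + 1 by push_cast; ring, ← mul_assoc, pow_succ]
    have h : ‖z + n‖ ≤ ‖z‖ + n := (norm_add_le _ _).trans (by simp)
    push_cast
    gcongr <;> linarith

/-- `Γ(u) Γ(c) = Γ(u + c) B(u, c)`, and for `Re u ≥ r` the Beta integral is dominated by its
absolute value at `u = r`. -/
theorem Complex.exists_norm_Gamma_le_norm_Gamma_add {r c : ℝ} (hr : 0 < r) (hc : 0 < c) :
    ∃ K : ℝ, 0 ≤ K ∧ ∀ u : ℂ, r ≤ u.re → ‖Gamma u‖ ≤ K * ‖Gamma (u + c)‖ := by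
  set g : ℝ → ℂ := fun x => (x : ℂ) ^ ((r : ℂ) - 1) * (1 - (x : ℂ)) ^ ((c : ℂ) - 1) with hg
  have hgi : IntervalIntegrable g MeasureTheory.volume 0 1 :=
    betaIntegral_convergent (by simpa using hr) (by simpa using hc)
  have hG : 0 < Real.Gamma c := Real.Gamma_pos_of_pos hc
  have hI : 0 ≤ ∫ x in (0 : ℝ)..1, ‖g x‖ :=
    intervalIntegral.integral_nonneg zero_le_one fun x _ => norm_nonneg _
  refine ⟨(∫ x in (0 : ℝ)..1, ‖g x‖) / Real.Gamma c, by positivity, fun u hu => ?_⟩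
  have hB : ‖betaIntegral u c‖ ≤ ∫ x in (0 : ℝ)..1, ‖g x‖ := by
    refine intervalIntegral.norm_integral_le_of_norm_le zero_le_one ?_ hgi.norm
    have h1 : ∀ᵐ x : ℝ, x ≠ 1 := by simp [MeasureTheory.ae_iff, MeasureTheory.measure_singleton]
    filter_upwards [h1] with x hx1 hx
    have hx0 : 0 < x := hx.1
    have hx2 : 0 < 1 - x := sub_pos.2 (lt_of_le_of_ne hx.2 hx1)
    simp only [hg]
    rw [norm_mul, norm_mul, norm_cpow_eq_rpow_re_of_pos hx0, norm_cpow_eq_rpow_re_of_pos hx0]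
    gcongr ?_ * _
    refine Real.rpow_le_rpow_of_exponent_ge hx0 hx.2 ?_
    simpa using hu
  have h := Gamma_mul_Gamma_eq_betaIntegral (s := u) (t := c) (hr.trans_le hu) (by simpa using hc)
  have h2 := congrArg norm h
  rw [norm_mul, norm_mul, Gamma_ofReal, norm_real, Real.norm_of_nonneg hG.le] at h2
  rw [div_mul_eq_mul_div, le_div_iff₀ hG, h2, mul_comm]
  gcongr

theorem Complex.norm_inv_Gamma_le_reflection {z : ℂ} (hz : ∀ j : ℕ, 1 ≤ ‖1 - z + j‖) :
    ‖(Gamma z)⁻¹‖ ≤ ‖Gamma (1 - z)‖ * ‖sin (Real.pi * z)‖ := by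
  have h := Gamma_mul_Gamma_one_sub z
  have hpi : (Real.pi : ℂ) ≠ 0 := by exact_mod_cast Real.pi_ne_zero
  have h1 : Gamma (1 - z) ≠ 0 := Gamma_ne_zero fun m hm => by
    have := hz m
    rw [hm, neg_add_cancel, norm_zero] at this
    linarith
  -- When the sine vanishes, division by zero turns the reflection formula into `Γ(z) Γ(1 - z) = 0`,
  -- which forces `Γ(z) = 0` and makes the left side zero.
  rcases eq_or_ne (sin (Real.pi * z)) 0 with hs | hs
  · rw [hs, div_zero, mul_eq_zero, or_iff_left h1] at h
    simp [h, hs]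
  · have h2 : (Gamma z)⁻¹ = Gamma (1 - z) * sin (Real.pi * z) / Real.pi := by
      have h3 : Gamma z ≠ 0 := fun h3 => by
        rw [h3, zero_mul, eq_comm, div_eq_zero_iff] at h
        tauto
      rw [eq_div_iff hs] at h
      rw [eq_div_iff hpi, inv_mul_eq_iff_eq_mul₀ h3]
      linear_combination -h
    rw [h2, norm_div, norm_mul, norm_real, Real.norm_of_nonneg Real.pi_pos.le]
    exact div_le_self (by positivity) (by linarith [Real.pi_gt_three])

/-- The entire function `1 / (Γ(a + w) Γ(a - w))`. -/
noncomputable def recipGammaPair (a : ℝ) (w : ℂ) : ℂ :=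
  (Complex.Gamma (a + w))⁻¹ * (Complex.Gamma (a - w))⁻¹

theorem differentiable_recipGammaPair (a : ℝ) : Differentiable ℂ (recipGammaPair a) := by
  unfold recipGammaPair
  exact (Complex.differentiable_one_div_Gamma.comp (differentiable_id.const_add _)).mul
    (Complex.differentiable_one_div_Gamma.comp (differentiable_id.const_sub _))

theorem recipGammaPair_neg (a : ℝ) (w : ℂ) : recipGammaPair a (-w) = recipGammaPair a w := by
  rw [recipGammaPair, recipGammaPair, sub_neg_eq_add, ← sub_eq_add_neg, mul_comm]

theorem one_le_norm_one_sub_add {a : ℝ} {w : ℂ} (h : a ≤ w.re ∨ 1 ≤ |w.im|) (j : ℕ) :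
    1 ≤ ‖1 - (a - w) + j‖ := by
  rcases h with h | h
  · refine le_trans ?_ (Complex.re_le_norm _)
    have : (0 : ℝ) ≤ j := j.cast_nonneg
    simp
    linarith
  · refine h.trans ?_
    have := Complex.abs_im_le_norm (1 - (a - w) + j)
    simpa using this

/-- By symmetry take `Re w ≥ 0`. Reflection replaces `1/Γ(a - w)` by `Γ(1 - a + w)` times a sine of
size at most `exp(π|Im w|)`. After shifting arguments to the right, this gamma value is at most a
constant times `|Γ(a + w + N + 1)|`, which cancels against `1/Γ(a + w)` up to a polynomial factor.
The region near the poles is bounded and handled by compactness. -/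
theorem exists_norm_recipGammaPair_le {a : ℝ} (ha : 0 < a) :
    ∃ (C : ℝ) (N : ℕ), 0 ≤ C ∧ ∀ w : ℂ,
      ‖recipGammaPair a w‖ ≤ C * ((1 + ‖w‖) ^ N * Real.exp (Real.pi * |w.im|)) := by
  obtain ⟨N, hN⟩ := exists_nat_gt a
  -- `N > a` makes `r` positive, and adding `c = 2a` takes `1 - a + w + N` to `a + w + N + 1`.
  obtain ⟨K, hK0, hK⟩ := Complex.exists_norm_Gamma_le_norm_Gamma_add
    (r := 1 - a + N) (c := 2 * a) (by linarith) (by linarith)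
  have hcont : Continuous (recipGammaPair a) := (differentiable_recipGammaPair a).continuous
  obtain ⟨B, hB⟩ := (isCompact_closedBall (0 : ℂ) (a + 1)).exists_bound_of_continuousOn
    hcont.continuousOn
  have hB0 : 0 ≤ B := (norm_nonneg _).trans (hB 0 (by simp; linarith))
  refine ⟨B + K * (a + N + 1) ^ (N + 1), N + 1, by positivity, ?_⟩
  suffices hmain : ∀ w : ℂ, 0 ≤ w.re → ‖recipGammaPair a w‖ ≤
      (B + K * (a + N + 1) ^ (N + 1)) *
        ((1 + ‖w‖) ^ (N + 1) * Real.exp (Real.pi * |w.im|)) by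
    intro w
    rcases le_total 0 w.re with h | h
    · exact hmain w h
    · have := hmain (-w) (by simpa using h)
      rwa [recipGammaPair_neg, norm_neg, Complex.neg_im, abs_neg] at this
  intro w hw
  by_cases h : a ≤ w.re ∨ 1 ≤ |w.im|
  · have h1 := Complex.norm_inv_Gamma_le_reflection (one_le_norm_one_sub_add h)
    have h2 := Complex.norm_Gamma_le_of_one_le (one_le_norm_one_sub_add h) N
    have h3 := Complex.norm_inv_Gamma_le (a + w) (N + 1)
    have h4 := hK (1 - (a - w) + N) (by simp; linarith)
    have h5 : 1 - (a - w) + N + ((2 * a : ℝ) : ℂ) = a + w + ((N + 1 : ℕ) : ℂ) := by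
      push_cast
      ring
    rw [h5] at h4
    set G := Complex.Gamma (a + w + ((N + 1 : ℕ) : ℂ)) with hG
    have hG0 : G ≠ 0 := Complex.Gamma_ne_zero_of_re_pos (by simp; linarith)
    have h6 : ‖Complex.sin (Real.pi * (a - w))‖ ≤ Real.exp (Real.pi * |w.im|) := by
      refine (Complex.norm_sin_le_exp_abs_im _).trans_eq ?_
      simp [abs_mul, abs_of_pos Real.pi_pos]
    have h7 : ‖(a : ℂ) + w‖ + ((N + 1 : ℕ) : ℝ) ≤ (a + N + 1) * (1 + ‖w‖) := by
      have : ‖(a : ℂ) + w‖ ≤ a + ‖w‖ := (norm_add_le _ _).trans_eq (by simp [abs_of_pos ha])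
      push_cast
      nlinarith [norm_nonneg w, mul_nonneg (add_nonneg ha.le N.cast_nonneg) (norm_nonneg w)]
    rw [recipGammaPair, norm_mul]
    calc ‖(Complex.Gamma (a + w))⁻¹‖ * ‖(Complex.Gamma (a - w))⁻¹‖
        ≤ (((a + N + 1) * (1 + ‖w‖)) ^ (N + 1) * ‖G⁻¹‖) *
          ((K * ‖G‖) * Real.exp (Real.pi * |w.im|)) := by
          refine mul_le_mul (h3.trans ?_) (h1.trans ?_) (norm_nonneg _) (by positivity)
          · gcongr
          · exact mul_le_mul (h2.trans h4) h6 (norm_nonneg _) (by positivity)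
      _ = (K * (a + N + 1) ^ (N + 1)) *
          ((1 + ‖w‖) ^ (N + 1) * Real.exp (Real.pi * |w.im|)) := by
          rw [norm_inv, mul_pow]
          have : ‖G‖ ≠ 0 := norm_ne_zero_iff.2 hG0
          field_simp
      _ ≤ _ := by
          gcongr
          linarith
  · push Not at h
    have h1 : ‖w‖ ≤ a + 1 := (Complex.norm_le_abs_re_add_abs_im w).trans (by
      rw [abs_of_nonneg hw]
      linarith [h.1, h.2])
    have h2 := hB w (by simpa using h1)
    have h3 : (1 : ℝ) ≤ (1 + ‖w‖) ^ (N + 1) * Real.exp (Real.pi * |w.im|) :=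
      one_le_mul_of_one_le_of_one_le (one_le_pow₀ (by linarith [norm_nonneg w]))
        (Real.one_le_exp (by have := Real.pi_pos; positivity))
    have h4 : 0 ≤ K * (a + N + 1) ^ (N + 1) := by positivity
    calc _ ≤ (B + K * (a + N + 1) ^ (N + 1)) * 1 := by linarith
      _ ≤ _ := by gcongr

/-- By convexity of `log Γ`, its slope over `[r, r + 1]`, which is `log r`, is at most its slope
over `[r, r + c]`. -/
theorem Real.rpow_mul_Gamma_le_Gamma_add {r c : ℝ} (hr : 0 < r) (hc : 1 ≤ c) :
    r ^ c * Gamma r ≤ Gamma (r + c) := by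
  have h1 : 0 < Gamma r := Gamma_pos_of_pos hr
  have h2 : 0 < Gamma (r + c) := Gamma_pos_of_pos (by linarith)
  have h := convexOn_log_Gamma.secant_mono (a := r) (x := r + 1) (y := r + c)
    (Set.mem_Ioi.2 hr) (Set.mem_Ioi.2 (by linarith)) (Set.mem_Ioi.2 (by linarith))
    (by linarith) (by linarith) (by linarith)
  simp only [Function.comp_apply, add_sub_cancel_left, div_one] at h
  rw [Gamma_add_one hr.ne', log_mul hr.ne' h1.ne', add_sub_cancel_right,
    le_div_iff₀ (by linarith)] at h
  rw [← log_le_log_iff (by positivity) h2, log_mul (by positivity) h1.ne', log_rpow hr]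
  linarith

/-- On the real line the sine is bounded, and what remains is `Γ(1 - a + x) / Γ(a + x)`, of order
`x^(1 - 2a)`. -/
theorem exists_norm_recipGammaPair_ofReal_le {a : ℝ} (ha : 0 < a) :
    ∃ C : ℝ, 0 ≤ C ∧ ∀ x : ℝ, 0 ≤ x →
      ‖recipGammaPair a x‖ ≤ C * (1 + x) ^ (1 - 2 * a) := by
  have hcont : ContinuousOn (fun x : ℝ => ‖recipGammaPair a x‖ * (1 + x) ^ (2 * a - 1))
      (Set.Icc 0 (2 * a)) := by
    refine ContinuousOn.mul ?_ (ContinuousOn.rpow_const (by fun_prop) fun x hx => ?_)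
    · have := (differentiable_recipGammaPair a).continuous
      exact Continuous.continuousOn (by fun_prop)
    · left
      linarith [hx.1]
  obtain ⟨B, hB⟩ := isCompact_Icc.exists_bound_of_continuousOn hcont
  have hB0 : 0 ≤ B := (norm_nonneg _).trans (hB 0 (by simp; linarith))
  refine ⟨B + 4 * 2 ^ (2 * a + 1), by positivity, fun x hx => ?_⟩
  have hx1 : 0 < 1 + x := by linarith
  have hp : 0 < (1 + x) ^ (1 - 2 * a) := by positivity
  rcases le_total x (2 * a) with h | h
  · have h1 := hB x ⟨hx, h⟩
    rw [Real.norm_of_nonneg (by positivity)] at h1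
    have h2 : (1 + x) ^ (2 * a - 1) = ((1 + x) ^ (1 - 2 * a))⁻¹ := by
      rw [← Real.rpow_neg hx1.le, neg_sub]
    rw [h2, ← div_eq_mul_inv, div_le_iff₀ hp] at h1
    have : 0 ≤ 4 * (2 : ℝ) ^ (2 * a + 1) * (1 + x) ^ (1 - 2 * a) := by positivity
    rw [add_mul]
    linarith
  -- The threshold `x ≥ 2a` makes `1 - a + x` comparable to `1 + x`.
  · have hr : (1 + x) / 2 ≤ 1 - a + x := by linarith
    have hr0 : 0 < 1 - a + x := by linarith
    have h1 := Complex.norm_inv_Gamma_le_reflection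
      (one_le_norm_one_sub_add (a := a) (w := x) (Or.inl (by simp; linarith)))
    have h2 : ‖Complex.sin (Real.pi * (a - x))‖ ≤ 1 := by
      have : Complex.sin (Real.pi * (a - x)) = (Real.sin (Real.pi * (a - x)) : ℂ) := by
        push_cast
        rfl
      rw [this, Complex.norm_real]
      exact Real.abs_sin_le_one _
    have h3 : Complex.Gamma (1 - (a - x)) = (Real.Gamma (1 - a + x) : ℂ) := by
      rw [← Complex.Gamma_ofReal]
      congr 1
      push_cast
      ring
    have h4 : Complex.Gamma (a + x) = (Real.Gamma (a + x) : ℂ) := by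
      rw [← Complex.Gamma_ofReal]
      push_cast
      rfl
    have hG1 : 0 < Real.Gamma (1 - a + x) := Real.Gamma_pos_of_pos hr0
    have hG2 : 0 < Real.Gamma (a + x) := Real.Gamma_pos_of_pos (by linarith)
    -- The natural increment `2a - 1` may be less than `1`, even negative; taking `2a + 1` instead
    -- costs two applications of the functional equation.
    have h5 : (1 - a + x) ^ (2 * a + 1) * Real.Gamma (1 - a + x) ≤
        (a + x + 1) * ((a + x) * Real.Gamma (a + x)) := by
      refine (Real.rpow_mul_Gamma_le_Gamma_add hr0 (by linarith)).trans_eq ?_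
      rw [← Real.Gamma_add_one (by linarith), ← Real.Gamma_add_one (by linarith)]
      congr 1
      ring
    have h6 : ‖(Complex.Gamma (a - x))⁻¹‖ ≤ Real.Gamma (1 - a + x) := by
      refine h1.trans ((mul_le_of_le_one_right (norm_nonneg _) h2).trans_eq ?_)
      rw [h3, Complex.norm_real, Real.norm_of_nonneg hG1.le]
    rw [recipGammaPair, norm_mul, h4, norm_inv, Complex.norm_real, Real.norm_of_nonneg hG2.le]
    have hP : 0 < (1 - a + x) ^ (2 * a + 1) := by positivity
    have h7 : (Real.Gamma (a + x))⁻¹ * Real.Gamma (1 - a + x) ≤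
        (a + x + 1) * (a + x) * ((1 - a + x) ^ (2 * a + 1))⁻¹ := by
      rw [← div_eq_mul_inv, inv_mul_eq_div, div_le_div_iff₀ hG2 hP]
      linarith
    have h8 : ((1 - a + x) ^ (2 * a + 1))⁻¹ ≤ 2 ^ (2 * a + 1) * (1 + x) ^ (-(2 * a + 1)) := by
      rw [Real.rpow_neg hx1.le, ← div_eq_mul_inv, ← inv_div, ← Real.div_rpow hx1.le two_pos.le]
      gcongr
    calc (Real.Gamma (a + x))⁻¹ * ‖(Complex.Gamma (a - x))⁻¹‖
        ≤ (Real.Gamma (a + x))⁻¹ * Real.Gamma (1 - a + x) := by gcongr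
      _ ≤ (a + x + 1) * (a + x) * ((1 - a + x) ^ (2 * a + 1))⁻¹ := h7
      _ ≤ (2 * (1 + x)) * (2 * (1 + x)) * (2 ^ (2 * a + 1) * (1 + x) ^ (-(2 * a + 1))) := by
          gcongr <;> linarith
      _ = 4 * 2 ^ (2 * a + 1) * (1 + x) ^ (1 - 2 * a) := by
          rw [show 1 - 2 * a = 1 + 1 + -(2 * a + 1) by ring, Real.rpow_add hx1,
            Real.rpow_add hx1, Real.rpow_one]
          ring
      _ ≤ _ := by
          gcongr
          linarith

theorem exists_one_add_mul_rpow_le {b : ℝ} (hb : 0 < b) (e : ℝ) :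
    ∃ K : ℝ, 0 ≤ K ∧ ∀ x : ℝ, 0 ≤ x → (1 + b * x) ^ e ≤ K * (1 + x) ^ e := by
  rcases le_total 0 e with he | he
  · refine ⟨(1 + b) ^ e, by positivity, fun x hx => ?_⟩
    rw [← Real.mul_rpow (by positivity) (by positivity)]
    refine Real.rpow_le_rpow (by positivity) ?_ he
    nlinarith
  · have hm : 0 < min 1 b := lt_min one_pos hb
    refine ⟨(min 1 b) ^ e, by positivity, fun x hx => ?_⟩
    rw [← Real.mul_rpow hm.le (by positivity)]
    refine Real.rpow_le_rpow_of_nonpos (by positivity) ?_ he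
    have h1 := min_le_left 1 b
    have h2 := mul_le_mul_of_nonneg_right (min_le_right 1 b) hx
    linarith

/-- The entire function extending `recipGammaProd`. -/
noncomputable def cRecipGammaProd {M : ℕ} (α β : Fin M → ℝ) (z : ℂ) : ℂ :=
  ∏ k, recipGammaPair (α k) (β k * z)

section

variable {M : ℕ} {α β : Fin M → ℝ}

theorem differentiable_cRecipGammaProd (α β : Fin M → ℝ) :
    Differentiable ℂ (cRecipGammaProd α β) := by
  unfold cRecipGammaProd
  refine Differentiable.fun_finsetProd fun k _ => ?_
  exact (differentiable_recipGammaPair (α k)).comp (differentiable_id.const_mul _)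

theorem cRecipGammaProd_neg (z : ℂ) : cRecipGammaProd α β (-z) = cRecipGammaProd α β z := by
  unfold cRecipGammaProd
  refine Finset.prod_congr rfl fun k _ => ?_
  rw [mul_neg, recipGammaPair_neg]

theorem cRecipGammaProd_ofReal (x : ℝ) :
    cRecipGammaProd α β x = (recipGammaProd α β x : ℂ) := by
  unfold cRecipGammaProd recipGammaProd recipGammaPair
  rw [one_div, ← Finset.prod_inv_distrib]
  push_cast
  refine Finset.prod_congr rfl fun k _ => ?_
  rw [← Complex.Gamma_ofReal, ← Complex.Gamma_ofReal]
  push_cast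
  rw [mul_inv]

theorem exists_norm_cRecipGammaProd_le (hα : ∀ k, 0 < α k) (hβ : ∀ k, 0 < β k) :
    ∃ (C : ℝ) (N : ℕ), 0 ≤ C ∧ ∀ z : ℂ, ‖cRecipGammaProd α β z‖ ≤
      C * ((1 + ‖z‖) ^ N * Real.exp (Real.pi * (∑ k, β k) * |z.im|)) := by
  choose C N hC0 hC using fun k => exists_norm_recipGammaPair_le (hα k)
  refine ⟨∏ k, (C k * (1 + β k) ^ N k), ∑ k, N k, ?_, fun z => ?_⟩
  · exact Finset.prod_nonneg fun k _ =>
      mul_nonneg (hC0 k) (pow_nonneg (by linarith [hβ k]) _)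
  · unfold cRecipGammaProd
    rw [norm_prod, Finset.mul_sum, Finset.sum_mul, Real.exp_sum, ← Finset.prod_pow_eq_pow_sum,
      ← Finset.prod_mul_distrib, ← Finset.prod_mul_distrib]
    refine Finset.prod_le_prod (fun k _ => norm_nonneg _) fun k _ => (hC k _).trans ?_
    have hk := hβ k
    have h1 : ‖(β k : ℂ) * z‖ = β k * ‖z‖ := by
      rw [norm_mul, Complex.norm_real, Real.norm_of_nonneg hk.le]
    have h2 : ((β k : ℂ) * z).im = β k * z.im := by simp
    rw [h1, h2, abs_mul, abs_of_pos hk, mul_assoc (C k), ← mul_assoc (_ ^ _), ← mul_pow,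
      ← mul_assoc Real.pi]
    have := hC0 k
    gcongr
    nlinarith [norm_nonneg z]

theorem exists_norm_cRecipGammaProd_ofReal_le (hα : ∀ k, 0 < α k) (hβ : ∀ k, 0 < β k) :
    ∃ C : ℝ, 0 ≤ C ∧ ∀ x : ℝ, 0 ≤ x →
      ‖cRecipGammaProd α β x‖ ≤ C * (1 + x) ^ ((M : ℝ) - 2 * ∑ k, α k) := by
  choose C hC0 hC using fun k => exists_norm_recipGammaPair_ofReal_le (hα k)
  choose K hK0 hK using fun k => exists_one_add_mul_rpow_le (hβ k) (1 - 2 * α k)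
  refine ⟨∏ k, (C k * K k), Finset.prod_nonneg fun k _ => mul_nonneg (hC0 k) (hK0 k),
    fun x hx => ?_⟩
  have hx1 : 0 < 1 + x := by linarith
  have he : (M : ℝ) - 2 * ∑ k, α k = ∑ k, (1 - 2 * α k) := by
    simp [Finset.mul_sum]
  unfold cRecipGammaProd
  rw [he, Real.rpow_sum_of_pos hx1, norm_prod, ← Finset.prod_mul_distrib]
  refine Finset.prod_le_prod (fun k _ => norm_nonneg _) fun k _ => ?_
  have h1 := hC k (β k * x) (mul_nonneg (hβ k).le hx)
  push_cast at h1
  refine h1.trans ?_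
  rw [mul_assoc]
  exact mul_le_mul_of_nonneg_left (hK k x hx) (hC0 k)

end

/-! ### Derivatives at the origin. -/

theorem iteratedDeriv_ofReal_eq {F : ℂ → ℂ} (hF : Differentiable ℂ F) {r : ℝ → ℝ}
    (hr : ∀ x : ℝ, F x = (r x : ℂ)) (n : ℕ) :
    ∀ x : ℝ, iteratedDeriv n F x = ((iteratedDeriv n r x : ℝ) : ℂ) := by
  induction n with
  | zero => simpa using hr
  | succ n ih =>
    intro x
    have hd : HasDerivAt (iteratedDeriv n F) (iteratedDeriv (n + 1) F x) x := by
      rw [iteratedDeriv_succ]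
      exact ((hF.contDiff (n := (n + 1 : ℕ))).differentiable_iteratedDeriv n
        (by exact_mod_cast Nat.lt_succ_self n)).differentiableAt.hasDerivAt
    have h1 := hd.comp_ofReal
    simp_rw [ih] at h1
    have hre : HasDerivAt (iteratedDeriv n r) (iteratedDeriv (n + 1) F x).re x := by
      simpa using! (Complex.reCLM.hasFDerivAt.comp_hasDerivAt x h1)
    have him : HasDerivAt (fun _ : ℝ => (0 : ℝ)) (iteratedDeriv (n + 1) F x).im x := by
      simpa using! (Complex.imCLM.hasFDerivAt.comp_hasDerivAt x h1)
    rw [iteratedDeriv_succ (f := r), hre.deriv]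
    apply Complex.ext
    · simp
    · simpa using him.unique (hasDerivAt_const x 0)

theorem iteratedDeriv_id_mul {g : ℂ → ℂ} (hg : Differentiable ℂ g) (n : ℕ) :
    iteratedDeriv (n + 1) (fun z => z * g z) =
      fun z => z * iteratedDeriv (n + 1) g z + (n + 1) * iteratedDeriv n g z := by
  have hd : ∀ k z, HasDerivAt (iteratedDeriv k g) (iteratedDeriv (k + 1) g z) z := fun k z => by
    rw [iteratedDeriv_succ]
    exact ((hg.contDiff (n := (k + 1 : ℕ))).differentiable_iteratedDeriv k
      (by exact_mod_cast Nat.lt_succ_self k)).differentiableAt.hasDerivAt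
  induction n with
  | zero =>
    funext z
    have h := (hasDerivAt_id z).mul (hd 0 z)
    simp only [iteratedDeriv_zero, id_eq] at h
    rw [zero_add, iteratedDeriv_one]
    refine h.deriv.trans ?_
    simp
    ring
  | succ n ih =>
    funext z
    rw [iteratedDeriv_succ, ih]
    have h := ((hasDerivAt_id z).mul (hd (n + 1) z)).add ((hd n z).const_mul ((n : ℂ) + 1))
    refine h.deriv.trans ?_
    simp only [id_eq]
    push_cast
    ring

/-- For `n < k` the falling factorial is zero, so the truncated `n - k` is harmless. This vanishing
removes the low-order terms of the final formula. -/
theorem iteratedDeriv_pow_mul_zero {g : ℂ → ℂ} (hg : Differentiable ℂ g) (k : ℕ) :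
    ∀ n, iteratedDeriv n (fun z => z ^ k * g z) 0 =
      (n.descFactorial k : ℂ) * iteratedDeriv (n - k) g 0 := by
  induction k with
  | zero => simp
  | succ k ih =>
    intro n
    have hd : Differentiable ℂ fun z => z ^ k * g z := by fun_prop
    have e : (fun z => z ^ (k + 1) * g z) = fun z => z * (z ^ k * g z) := by
      funext z
      ring
    rw [e]
    rcases n with _ | n
    · simp
    · simp only [iteratedDeriv_id_mul hd, zero_mul, zero_add]
      rw [ih, Nat.succ_descFactorial_succ, Nat.add_sub_add_right]
      push_cast
      ring

/-! ### Damping by `sin z / z` and the limiting argument. -/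

/-- The entire function `sin z / z`. -/
noncomputable def entireSinc : ℂ → ℂ := dslope Complex.sin 0

theorem entireSinc_zero : entireSinc 0 = 1 := by
  simp [entireSinc]

theorem entireSinc_of_ne {z : ℂ} (hz : z ≠ 0) : entireSinc z = Complex.sin z / z := by
  simp [entireSinc, dslope_of_ne _ hz, slope_def_field]

theorem differentiable_entireSinc : Differentiable ℂ entireSinc := by
  rw [← differentiableOn_univ]
  exact (Complex.differentiableOn_dslope Filter.univ_mem).2
    Complex.differentiable_sin.differentiableOn

theorem entireSinc_neg (z : ℂ) : entireSinc (-z) = entireSinc z := by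
  rcases eq_or_ne z 0 with rfl | hz
  · simp
  · rw [entireSinc_of_ne hz, entireSinc_of_ne (neg_ne_zero.2 hz), Complex.sin_neg, neg_div_neg_eq]

theorem norm_entireSinc_ofReal_le (x : ℝ) : ‖entireSinc x‖ ≤ 1 := by
  rcases eq_or_ne x 0 with rfl | hx
  · simp [entireSinc_zero]
  · rw [entireSinc_of_ne (by exact_mod_cast hx), norm_div, ← Complex.ofReal_sin,
      Complex.norm_real, Complex.norm_real, div_le_one (norm_pos_iff.2 hx)]
    exact Real.abs_sin_le_abs

theorem exists_norm_entireSinc_le :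
    ∃ C : ℝ, 0 ≤ C ∧ ∀ z : ℂ, ‖entireSinc z‖ * (1 + ‖z‖) ≤ C * Real.exp |z.im| := by
  obtain ⟨B, hB⟩ := (isCompact_closedBall (0 : ℂ) 1).exists_bound_of_continuousOn
    differentiable_entireSinc.continuous.continuousOn
  have hB0 : 0 ≤ B := (norm_nonneg _).trans (hB 0 (by simp))
  refine ⟨2 * B + 2, by positivity, fun z => ?_⟩
  have h1 : 1 ≤ Real.exp |z.im| := Real.one_le_exp (abs_nonneg _)
  rcases le_total ‖z‖ 1 with h | h
  · have h2 := hB z (by simpa using h)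
    calc ‖entireSinc z‖ * (1 + ‖z‖) ≤ B * (1 + 1) := by gcongr
      _ ≤ (2 * B + 2) * 1 := by linarith
      _ ≤ _ := by gcongr
  · have hz : z ≠ 0 := by
      rintro rfl
      simp at h
      linarith
    have hz0 : 0 < ‖z‖ := norm_pos_iff.2 hz
    rw [entireSinc_of_ne hz, norm_div, div_mul_eq_mul_div, div_le_iff₀ hz0]
    calc ‖Complex.sin z‖ * (1 + ‖z‖) ≤ Real.exp |z.im| * (2 * ‖z‖) := by
          gcongr
          · exact Complex.norm_sin_le_exp_abs_im z
          · linarith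
      _ = (0 + 2) * Real.exp |z.im| * ‖z‖ := by ring
      _ ≤ _ := by
          gcongr
          linarith

/-- Damping an entire function of exponential type by powers of `sin (ε z) / (ε z)`. -/
theorem decayingExpType_mul_entireSinc_pow {F : ℂ → ℂ} (hF : Differentiable ℂ F) {C b : ℝ}
    {A : ℕ} (hC0 : 0 ≤ C)
    (hC : ∀ z : ℂ, ‖F z‖ ≤ C * ((1 + ‖z‖) ^ A * Real.exp (b * |z.im|))) {ε : ℝ} (hε : 0 < ε)
    (hε1 : ε ≤ 1) :
    DecayingExpType (b + (A + 2 : ℕ) * ε) fun z => F z * entireSinc (ε * z) ^ (A + 2) := by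
  obtain ⟨S, hS0, hS⟩ := exists_norm_entireSinc_le
  refine ⟨hF.mul ((differentiable_entireSinc.comp (differentiable_id.const_mul _)).pow _),
    C * (S / ε) ^ (A + 2), by positivity, fun z => ?_⟩
  have hz : 0 < 1 + ‖z‖ := by positivity
  have h1 : ‖entireSinc (ε * z)‖ ≤ S / ε * Real.exp (ε * |z.im|) / (1 + ‖z‖) := by
    have h := hS (ε * z)
    have e1 : ‖(ε : ℂ) * z‖ = ε * ‖z‖ := by
      rw [norm_mul, Complex.norm_real, Real.norm_of_nonneg hε.le]
    have e2 : ((ε : ℂ) * z).im = ε * z.im := by simp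
    rw [e1, e2, abs_mul, abs_of_pos hε] at h
    rw [le_div_iff₀ hz, div_mul_eq_mul_div, le_div_iff₀ hε]
    refine le_trans ?_ h
    rw [mul_assoc]
    gcongr
    linarith
  rw [norm_mul, norm_pow]
  -- Of the `A + 2` factors, `A` cancel the polynomial growth and two give the quadratic decay; each
  -- adds `ε` to the type.
  calc ‖F z‖ * ‖entireSinc (ε * z)‖ ^ (A + 2)
      ≤ (C * ((1 + ‖z‖) ^ A * Real.exp (b * |z.im|))) *
        (S / ε * Real.exp (ε * |z.im|) / (1 + ‖z‖)) ^ (A + 2) := by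
        gcongr
        exact hC z
    _ = _ := by
        rw [add_mul, Real.exp_add, mul_assoc ((A + 2 : ℕ) : ℝ) ε, Real.exp_nat_mul,
          Real.rpow_neg hz.le, Real.rpow_two, div_pow, mul_pow]
        field_simp
        ring

/-- By Leibniz the derivative is a polynomial in `ε`, whose constant term is the one with all
derivatives on `F`. -/
theorem tendsto_iteratedDeriv_mul_comp_mul {F T : ℂ → ℂ} (hF : Differentiable ℂ F)
    (hT : Differentiable ℂ T) (hT0 : T 0 = 1) (n : ℕ) :
    Filter.Tendsto (fun ε : ℝ => iteratedDeriv n (fun z => F z * T (ε * z)) 0) (nhds 0)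
      (nhds (iteratedDeriv n F 0)) := by
  have h : ∀ ε : ℝ, iteratedDeriv n (fun z => F z * T (ε * z)) 0 =
      ∑ i ∈ Finset.range (n + 1), n.choose i * iteratedDeriv i F 0 *
        ((ε : ℂ) ^ (n - i) * iteratedDeriv (n - i) T 0) := by
    intro ε
    have hg : Differentiable ℂ fun z => T (ε * z) := hT.comp (differentiable_id.const_mul _)
    rw [iteratedDeriv_fun_mul hF.contDiff.contDiffAt hg.contDiff.contDiffAt]
    refine Finset.sum_congr rfl fun i _ => ?_
    rw [iteratedDeriv_comp_const_mul hT.contDiff]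
    simp
  have hc : Continuous fun ε : ℝ => iteratedDeriv n (fun z => F z * T (ε * z)) 0 := by
    simp_rw [h]
    fun_prop
  have h0 := hc.tendsto 0
  simpa [hT0] using h0

/-- Uniformity in `μ ≥ lam` is needed because the frequency moves with `ε` in the limit. -/
theorem exists_abs_besselJ_mul_le (n : ℕ) {lam : ℝ} (hlam : 0 < lam) :
    ∃ B : ℝ, 0 ≤ B ∧ ∀ μ : ℝ, lam ≤ μ → ∀ x : ℝ, 0 ≤ x →
      |besselJ n (μ * x)| ≤ B * (1 + x) ^ (-(1 / 2) : ℝ) := by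
  obtain ⟨B, hB0, hB⟩ := exists_abs_besselJ_le n
  obtain ⟨K, hK0, hK⟩ := exists_one_add_mul_rpow_le hlam (-(1 / 2))
  refine ⟨B * K, by positivity, fun μ hμ x hx => ?_⟩
  refine (hB (μ * x) (mul_nonneg (hlam.le.trans hμ) hx)).trans ?_
  rw [mul_assoc]
  refine mul_le_mul_of_nonneg_left (le_trans ?_ (hK x hx)) hB0
  refine Real.rpow_le_rpow_of_nonpos (by positivity) ?_ (by norm_num)
  have := mul_le_mul_of_nonneg_right hμ hx
  linarith

theorem integral_mul_besselJ_of_expType {F : ℂ → ℂ} (hF : Differentiable ℂ F)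
    (heven : ∀ z, F (-z) = F z) {C b : ℝ} {A : ℕ} (hb : 0 ≤ b) (hC0 : 0 ≤ C)
    (hC : ∀ z : ℂ, ‖F z‖ ≤ C * ((1 + ‖z‖) ^ A * Real.exp (b * |z.im|))) {lam : ℝ}
    (hlam0 : 0 < lam) (hlam : b ≤ lam) {D e : ℝ} (hD0 : 0 ≤ D) (he : e < -(1 / 2))
    (hD : ∀ x : ℝ, 0 ≤ x → ‖F x‖ ≤ D * (1 + x) ^ e) (l : ℕ) :
    MeasureTheory.IntegrableOn (fun x : ℝ => F x * (besselJ (2 * l + 1) (lam * x) : ℂ))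
      (Set.Ioi 0) ∧
    ∫ x in Set.Ioi (0 : ℝ), F x * (besselJ (2 * l + 1) (lam * x) : ℂ) =
      1 / lam * ∑ i ∈ Finset.range (l + 1), ((l + i).choose (l - i) : ℂ) *
        ((2 / lam) ^ (2 * i) * iteratedDeriv (2 * i) F 0) := by
  obtain ⟨B, hB0, hB⟩ := exists_abs_besselJ_mul_le (2 * l + 1) hlam0
  have hdom : MeasureTheory.IntegrableOn (fun x : ℝ => D * B * (x + 1) ^ (e + -(1 / 2)))
      (Set.Ioi 0) :=
    (integrableOn_add_rpow_Ioi_of_lt (by linarith) (by norm_num)).const_mul _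
  have hle : ∀ μ : ℝ, lam ≤ μ → ∀ x : ℝ, 0 < x →
      ‖F x‖ * ‖(besselJ (2 * l + 1) (μ * x) : ℂ)‖ ≤ D * B * (x + 1) ^ (e + -(1 / 2)) := by
    intro μ hμ x hx
    have hx1 : 0 < 1 + x := by linarith
    rw [Complex.norm_real, add_comm x 1, Real.rpow_add hx1]
    calc _ ≤ (D * (1 + x) ^ e) * (B * (1 + x) ^ (-(1 / 2) : ℝ)) :=
          mul_le_mul (hD x hx.le) (hB μ hμ x hx.le) (abs_nonneg _) (by positivity)
      _ = _ := by ring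
  have hFc : Continuous fun x : ℝ => F x := hF.continuous.comp Complex.continuous_ofReal
  have hJc := continuous_besselJ (2 * l + 1)
  refine ⟨hdom.mono' (hFc.mul (by fun_prop)).aestronglyMeasurable
    ((MeasureTheory.ae_restrict_mem measurableSet_Ioi).mono fun x hx => ?_), ?_⟩
  · rw [norm_mul]
    exact hle lam le_rfl x hx
  set T : ℂ → ℂ := fun z => entireSinc z ^ (A + 2) with hT
  have hTd : Differentiable ℂ T := differentiable_entireSinc.pow _
  have hT0 : T 0 = 1 := by simp [hT, entireSinc_zero]
  have hTc := hTd.continuous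
  -- The damped function has type `b + (A + 2)ε`; the extra `ε` keeps the frequency strictly above
  -- it even when `b = lam`.
  set μ : ℝ → ℝ := fun ε => lam + ((A + 2 : ℕ) + 1) * ε with hμ
  have hμc : Continuous μ := by fun_prop
  have hμ0 : μ 0 = lam := by simp [hμ]
  have hleft : Filter.Tendsto (fun ε : ℝ => ∫ x in Set.Ioi (0 : ℝ),
      F x * T (ε * x) * (besselJ (2 * l + 1) (μ ε * x) : ℂ)) (nhdsWithin 0 (Set.Ioi 0))
      (nhds (∫ x in Set.Ioi (0 : ℝ), F x * (besselJ (2 * l + 1) (lam * x) : ℂ))) := by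
    refine MeasureTheory.tendsto_integral_filter_of_dominated_convergence _
      (Filter.Eventually.of_forall fun ε => ?_) ?_ hdom
      (Filter.Eventually.of_forall fun x => ?_)
    · exact ((hFc.mul (by fun_prop)).mul (by fun_prop)).aestronglyMeasurable
    · filter_upwards [self_mem_nhdsWithin] with ε hε
      have hε0 : 0 < ε := hε
      refine (MeasureTheory.ae_restrict_mem measurableSet_Ioi).mono fun x hx => ?_
      rw [norm_mul, norm_mul]
      have h1 : ‖T (ε * x)‖ ≤ 1 := by
        simp only [hT]
        rw [norm_pow, ← Complex.ofReal_mul]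
        exact pow_le_one₀ (norm_nonneg _) (norm_entireSinc_ofReal_le _)
      refine le_trans ?_ (hle (μ ε) ?_ x hx)
      · gcongr
        exact mul_le_of_le_one_right (norm_nonneg _) h1
      · simp only [hμ]
        have : 0 ≤ (((A + 2 : ℕ) : ℝ) + 1) * ε := by positivity
        linarith
    · have hc : Continuous fun ε : ℝ =>
          F x * T (ε * x) * (besselJ (2 * l + 1) (μ ε * x) : ℂ) := by fun_prop
      have := (hc.tendsto 0).mono_left (nhdsWithin_le_nhds (s := Set.Ioi 0))
      simpa [hT0, hμ0] using this
  have hright : Filter.Tendsto (fun ε : ℝ => 1 / (μ ε : ℂ) * ∑ i ∈ Finset.range (l + 1),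
      ((l + i).choose (l - i) : ℂ) * ((2 / (μ ε : ℂ)) ^ (2 * i) *
        iteratedDeriv (2 * i) (fun z => F z * T (ε * z)) 0)) (nhdsWithin 0 (Set.Ioi 0))
      (nhds (1 / lam * ∑ i ∈ Finset.range (l + 1), ((l + i).choose (l - i) : ℂ) *
        ((2 / lam) ^ (2 * i) * iteratedDeriv (2 * i) F 0))) := by
    have h1 : Filter.Tendsto (fun ε : ℝ => (μ ε : ℂ)) (nhds 0) (nhds (lam : ℂ)) := by
      have hc : Continuous fun ε : ℝ => (μ ε : ℂ) := by fun_prop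
      simpa [hμ0] using hc.tendsto 0
    have hl : (lam : ℂ) ≠ 0 := by exact_mod_cast hlam0.ne'
    refine Filter.Tendsto.mono_left ?_ nhdsWithin_le_nhds
    refine (tendsto_const_nhds.div h1 hl).mul (tendsto_finsetSum _ fun i _ => ?_)
    exact (((tendsto_const_nhds.div h1 hl).pow _).mul
      (tendsto_iteratedDeriv_mul_comp_mul hF hTd hT0 _)).const_mul _
  refine tendsto_nhds_unique hleft (hright.congr' ?_)
  filter_upwards [Ioc_mem_nhdsGT (zero_lt_one (α := ℝ))] with ε hε
  have hdec := decayingExpType_mul_entireSinc_pow hF hC0 hC hε.1 hε.2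
  refine (hdec.integral_mul_besselJ_two_mul_add_one ?_ ?_ l fun z => ?_).symm
  · have := hε.1
    positivity
  · simp only [hμ]
    have := hε.1
    linarith
  · rw [heven, mul_neg, entireSinc_neg]

/-! ### Evaluation for products of gamma functions. -/

theorem integrableOn_and_integral_recipGammaProd {M : ℕ} (m l : ℕ) (α β : Fin M → ℝ) {lam : ℝ}
    (hα : ∀ k, 0 < α k) (hβ : ∀ k, 0 < β k)
    (hsum : (m : ℝ) + ((M : ℝ) + 1 / 2) / 2 < ∑ k, α k) (hlam : Real.pi * ∑ k, β k ≤ lam) :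
    MeasureTheory.IntegrableOn
      (fun x : ℝ => x ^ (2 * m) * recipGammaProd α β x * besselJ (2 * l + 1) (lam * x))
      (Set.Ioi 0) ∧
    ∫ x in Set.Ioi (0 : ℝ),
      x ^ (2 * m) * recipGammaProd α β x * besselJ (2 * l + 1) (lam * x) =
      1 / lam * ∑ i ∈ Finset.range (l + 1), ((l + i).choose (l - i) : ℝ) *
        ((2 / lam) ^ (2 * i) *
          (((2 * i).descFactorial (2 * m) : ℝ) * iteratedDeriv (2 * i - 2 * m)
            (recipGammaProd α β) 0)) := by
  -- For `M = 0` the hypothesis would read `m + 1/4 < 0`. Positivity of `M` makes `∑ β_k`, hence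
  -- `lam`, positive.
  have hM : 0 < M := by
    rcases Nat.eq_zero_or_pos M with rfl | h
    · have : (0 : ℝ) ≤ m := m.cast_nonneg
      simp at hsum
      linarith
    · exact h
  have hβs : 0 < ∑ k, β k :=
    Finset.sum_pos (fun k _ => hβ k) ⟨⟨0, hM⟩, Finset.mem_univ _⟩
  have hb : 0 < Real.pi * ∑ k, β k := mul_pos Real.pi_pos hβs
  have hlam0 : 0 < lam := hb.trans_le hlam
  set R := cRecipGammaProd α β with hR
  have hRd : Differentiable ℂ R := differentiable_cRecipGammaProd α β
  obtain ⟨C, N, hC0, hC⟩ := exists_norm_cRecipGammaProd_le hα hβ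
  obtain ⟨D, hD0, hD⟩ := exists_norm_cRecipGammaProd_ofReal_le hα hβ
  have h := integral_mul_besselJ_of_expType (F := fun z => z ^ (2 * m) * R z)
    (A := 2 * m + N) (C := C) (b := Real.pi * ∑ k, β k) (lam := lam) (D := D)
    -- The condition on `∑ α_k` says exactly that this exponent is below `-1/2`.
    (e := (2 * m : ℕ) + ((M : ℝ) - 2 * ∑ k, α k))
    ((differentiable_id.pow _).mul hRd)
    (fun z => by rw [hR, cRecipGammaProd_neg, (even_two_mul m).neg_pow]) hb.le hC0
    (fun z => by
      rw [norm_mul, norm_pow]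
      calc ‖z‖ ^ (2 * m) * ‖R z‖ ≤ (1 + ‖z‖) ^ (2 * m) *
            (C * ((1 + ‖z‖) ^ N * Real.exp (Real.pi * (∑ k, β k) * |z.im|))) := by
            gcongr
            · linarith
            · exact hC z
        _ = _ := by
            rw [pow_add]
            ring)
    hlam0 hlam hD0 (by push_cast; linarith)
    (fun x hx => by
      have hx1 : 0 < 1 + x := by linarith
      rw [norm_mul, norm_pow, Complex.norm_real, Real.norm_of_nonneg hx, Real.rpow_add hx1,
        Real.rpow_natCast]
      calc x ^ (2 * m) * ‖R x‖ ≤ (1 + x) ^ (2 * m) *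
            (D * (1 + x) ^ ((M : ℝ) - 2 * ∑ k, α k)) := by
            gcongr
            · linarith
            · exact hD x hx
        _ = _ := by ring) l
  have hcast : ∀ x : ℝ, (x : ℂ) ^ (2 * m) * R x * (besselJ (2 * l + 1) (lam * x) : ℂ) =
      ((x ^ (2 * m) * recipGammaProd α β x * besselJ (2 * l + 1) (lam * x) : ℝ) : ℂ) := by
    intro x
    rw [hR, cRecipGammaProd_ofReal]
    push_cast
    rfl
  simp_rw [hcast] at h
  refine ⟨h.1.re, ?_⟩
  have h2 := h.2
  rw [integral_complex_ofReal] at h2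
  have hder : ∀ n, iteratedDeriv n R 0 = ((iteratedDeriv n (recipGammaProd α β) 0 : ℝ) : ℂ) :=
    fun n => by
      have := iteratedDeriv_ofReal_eq hRd cRecipGammaProd_ofReal n 0
      simpa using this
  simp_rw [iteratedDeriv_pow_mul_zero hRd, hder] at h2
  exact_mod_cast h2

theorem gammaCoeff_zero {M : ℕ} (α β : Fin M → ℝ) :
    gammaCoeff α β 0 = recipGammaProd α β 0 := by
  simp [gammaCoeff]

section

variable {M m l : ℕ} {α β : Fin M → ℝ} {lam : ℝ}

theorem integral_recipGammaProd_of_le (hα : ∀ k, 0 < α k) (hβ : ∀ k, 0 < β k)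
    (hsum : (m : ℝ) + ((M : ℝ) + 1 / 2) / 2 < ∑ k, α k) (hlam : Real.pi * ∑ k, β k ≤ lam)
    (hml : m ≤ l) :
    ∫ x in Set.Ioi (0 : ℝ),
      x ^ (2 * m) * recipGammaProd α β x * besselJ (2 * l + 1) (lam * x) =
      1 / 2 * ∑ s ∈ Finset.range (l - m + 1),
        gammaCoeff α β s / ((2 * s).factorial : ℝ) *
          (((l + m + s).factorial : ℝ) / ((l - m - s).factorial : ℝ)) *
          (2 / lam) ^ (2 * m + 2 * s + 1) := by
  rw [(integrableOn_and_integral_recipGammaProd m l α β hα hβ hsum hlam).2,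
    show l + 1 = m + (l - m + 1) by omega, Finset.sum_range_add, Finset.sum_eq_zero, zero_add,
    Finset.mul_sum, Finset.mul_sum]
  · refine Finset.sum_congr rfl fun s hs => ?_
    have hs' : s ≤ l - m := Nat.lt_succ_iff.1 (Finset.mem_range.1 hs)
    rw [Nat.cast_choose ℝ (show l - (m + s) ≤ l + (m + s) by omega),
      show l + (m + s) - (l - (m + s)) = 2 * (m + s) by omega,
      show 2 * (m + s) - 2 * m = 2 * s by omega, Nat.sub_add_eq, ← Nat.add_assoc l m s,
      gammaCoeff]
    -- With `i = m + s`, the `(2i)!` in the denominator of the binomial coefficient cancels against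
    -- the falling factorial and leaves `1 / (2s)!`.
    have hd : ((2 * s).factorial : ℝ) * ((2 * (m + s)).descFactorial (2 * m) : ℝ) =
        ((2 * (m + s)).factorial : ℝ) := by
      have := Nat.factorial_mul_descFactorial (show 2 * m ≤ 2 * (m + s) by omega)
      rw [show 2 * (m + s) - 2 * m = 2 * s by omega] at this
      exact_mod_cast this
    rw [← hd]
    have h1 : ((2 * (m + s)).descFactorial (2 * m) : ℝ) ≠ 0 := by
      intro h
      rw [h, mul_zero] at hd
      exact absurd hd.symm (by positivity)
    have h2 : ((2 * s).factorial : ℝ) ≠ 0 := by positivity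
    have h3 : ((l - m - s).factorial : ℝ) ≠ 0 := by positivity
    rw [pow_succ, show 2 * m + 2 * s = 2 * (m + s) by ring]
    field_simp
  · intro i hi
    rw [Nat.descFactorial_of_lt (by have := Finset.mem_range.1 hi; omega)]
    simp

theorem integral_recipGammaProd_of_lt (hα : ∀ k, 0 < α k) (hβ : ∀ k, 0 < β k)
    (hsum : (m : ℝ) + ((M : ℝ) + 1 / 2) / 2 < ∑ k, α k) (hlam : Real.pi * ∑ k, β k ≤ lam)
    (hlm : l < m) :
    ∫ x in Set.Ioi (0 : ℝ),
      x ^ (2 * m) * recipGammaProd α β x * besselJ (2 * l + 1) (lam * x) = 0 := by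
  rw [(integrableOn_and_integral_recipGammaProd m l α β hα hβ hsum hlam).2,
    Finset.sum_eq_zero, mul_zero]
  intro i hi
  rw [Nat.descFactorial_of_lt (by have := Finset.mem_range.1 hi; omega)]
  simp

end

/-- The case `M = 1`, `β = 1`, `l = m`, where only `s = 0` remains; `m + 3/4` is the general
threshold for `M = 1`. -/
theorem integral_besselJ_div_Gamma_mul_Gamma {m : ℕ} {a lam : ℝ} (ha : (m : ℝ) + 3 / 4 < a)
    (hlam : Real.pi ≤ lam) :
    ∫ x in Set.Ioi (0 : ℝ), x ^ (2 * m) * besselJ (2 * m + 1) (lam * x) /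
      (Real.Gamma (a + x) * Real.Gamma (a - x)) =
      1 / 2 * (1 / Real.Gamma a ^ 2 * ((2 * m).factorial : ℝ) * (2 / lam) ^ (2 * m + 1)) := by
  have ha0 : 0 < a := by
    have : (0 : ℝ) ≤ m := m.cast_nonneg
    linarith
  have h := integral_recipGammaProd_of_le (M := 1) (m := m) (l := m) (α := fun _ => a)
    (β := fun _ => 1) (lam := lam) (fun _ => ha0) (fun _ => one_pos)
    (by simp; linarith) (by simpa using hlam) le_rfl
  rw [Nat.sub_self, zero_add, Finset.sum_range_one, gammaCoeff_zero] at h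
  have e : ∀ x : ℝ, x ^ (2 * m) * recipGammaProd (fun _ : Fin 1 => a) (fun _ => 1) x *
      besselJ (2 * m + 1) (lam * x) = x ^ (2 * m) * besselJ (2 * m + 1) (lam * x) /
      (Real.Gamma (a + x) * Real.Gamma (a - x)) := by
    intro x
    simp [recipGammaProd]
    ring
  simp_rw [e] at h
  rw [h]
  simp [recipGammaProd, sq, two_mul]

theorem Gamma_nat_add_half_mul_two_pow (K : ℕ) :
    Real.Gamma ((K : ℝ) + 1 / 2) * 2 ^ K =
      (∏ k ∈ Finset.Icc 1 K, (2 * (k : ℝ) - 1)) * √Real.pi := by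
  induction K with
  | zero => simpa using Real.Gamma_one_half_eq
  | succ K ih =>
    rw [Finset.prod_Icc_succ_top (by omega), mul_right_comm, ← ih,
      show ((K + 1 : ℕ) : ℝ) + 1 / 2 = (K : ℝ) + 1 / 2 + 1 by push_cast; ring,
      Real.Gamma_add_one (by positivity), pow_succ]
    push_cast
    ring

theorem proposition2 :
    (∀ (M m l : ℕ) (α β : Fin M → ℝ) (lam : ℝ),
      (∀ k, 0 < α k) → (∀ k, 0 < β k) →
      (m : ℝ) + ((M : ℝ) + 1 / 2) / 2 < ∑ k, α k →
      Real.pi * ∑ k, β k ≤ lam →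
      MeasureTheory.IntegrableOn
        (fun x : ℝ => x ^ (2 * m) * recipGammaProd α β x * besselJ (2 * l + 1) (lam * x))
        (Set.Ioi 0) ∧
      (m ≤ l →
        ∫ x in Set.Ioi (0 : ℝ),
            x ^ (2 * m) * recipGammaProd α β x * besselJ (2 * l + 1) (lam * x) =
          1 / 2 * ∑ s ∈ Finset.range (l - m + 1),
            gammaCoeff α β s / ((2 * s).factorial : ℝ) *
              (((l + m + s).factorial : ℝ) / ((l - m - s).factorial : ℝ)) *
              (2 / lam) ^ (2 * m + 2 * s + 1)) ∧
      (l < m →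
        ∫ x in Set.Ioi (0 : ℝ),
            x ^ (2 * m) * recipGammaProd α β x * besselJ (2 * l + 1) (lam * x) = 0)) ∧
    (∫ x in Set.Ioi (0 : ℝ),
        besselJ 1 (Real.pi * x) / (Real.Gamma (1 + x) * Real.Gamma (1 - x)) = 1 / Real.pi) ∧
    (∀ (m n : ℕ) (lam : ℝ), 1 ≤ n → Real.pi ≤ lam →
      1 / Real.pi =
        (∏ k ∈ Finset.Icc 1 (m + n), (2 * (k : ℝ) - 1)) ^ 2 * lam ^ (2 * m + 1) /
            (((2 * m).factorial : ℝ) * 2 ^ (4 * m + 2 * n)) *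
          ∫ x in Set.Ioi (0 : ℝ),
            x ^ (2 * m) * besselJ (2 * m + 1) (lam * x) /
              (Real.Gamma ((m : ℝ) + (n : ℝ) + 1 / 2 + x) *
                Real.Gamma ((m : ℝ) + (n : ℝ) + 1 / 2 - x))) := by
  refine ⟨fun M m l α β lam hα hβ hsum hlam =>
    ⟨(integrableOn_and_integral_recipGammaProd m l α β hα hβ hsum hlam).1,
      integral_recipGammaProd_of_le hα hβ hsum hlam,
      integral_recipGammaProd_of_lt hα hβ hsum hlam⟩, ?_, fun m n lam hn hlam => ?_⟩
  · have h := integral_besselJ_div_Gamma_mul_Gamma (m := 0) (a := 1) (by norm_num)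
      (le_refl Real.pi)
    simp only [mul_zero, pow_zero, one_mul, zero_add] at h
    rw [h, Real.Gamma_one]
    simp
    ring
  · have hn' : (1 : ℝ) ≤ n := by exact_mod_cast hn
    have hpi := Real.pi_pos
    have hlam0 : 0 < lam := hpi.trans_le hlam
    rw [integral_besselJ_div_Gamma_mul_Gamma (a := (m : ℝ) + n + 1 / 2) (by linarith) hlam]
    have hG := Gamma_nat_add_half_mul_two_pow (m + n)
    push_cast at hG
    set G := Real.Gamma ((m : ℝ) + n + 1 / 2) with hGdef
    set P := ∏ k ∈ Finset.Icc 1 (m + n), (2 * (k : ℝ) - 1) with hP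
    have hG0 : 0 < G := Real.Gamma_pos_of_pos (by positivity)
    -- Squaring the half-integer gamma value turns its `√π` into the `π` of the formula.
    have hsq : G ^ 2 * (2 ^ (m + n)) ^ 2 = P ^ 2 * Real.pi := by
      rw [← mul_pow, hG, mul_pow, Real.sq_sqrt hpi.le]
    have hP2 : P ^ 2 = G ^ 2 * (2 ^ (m + n)) ^ 2 / Real.pi := by
      rw [hsq]
      field_simp
    have hf : ((2 * m).factorial : ℝ) ≠ 0 := by positivity
    rw [hP2, div_pow]
    field_simp
    ring
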